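/- Let $\mathcal H$ be a complex Hilbert space and $\Lambda$ an arbitrary index set. Let $Q=\{Q_{\alpha\beta}:\alpha\neq\beta\in\Lambda\}$ be unitaries on $\mathcal H$ that commute with one another and satisfy $Q_{\alpha\beta}=Q_{\beta\alpha}^*$. A family $\mathcal T=\{T_\alpha:\alpha\in\Lambda\}$ of bounded operators on $\mathcal H$ is called $Q$-commuting if $T_\alpha T_\beta=Q_{\alpha\beta}T_\beta T_\alpha$ and $T_\gamma Q_{\alpha\beta}=Q_{\alpha\beta}T_\gamma$ for all $\alpha,\beta,\gamma\in\Lambda$ with $\alpha\ne\beta$; it is doubly $Q$-commuting if in addition $T_\alpha T_\beta^*=Q_{\alpha\beta}^*T_\beta^*T_\alpha$ for all $\alpha\ne\beta$. For $m\in\mathbb Z$ put $m^+=\max\{m,0\}$ and $m^-=-\min\{m,0\}$. A $Q$-commuting family $\mathcal T$ of contractions on $\mathcal H$ is said to admit a regular $Q$-unitary dilation if there are a Hilbert space $\mathcal K\supseteq\mathcal H$, a family $\widetilde Q=\{\widetilde Q_{\alpha\beta}:\alpha\ne\beta\}$ of commuting unitaries on $\mathcal K$ with $\widetilde Q_{\alpha\beta}=\widetilde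 Q_{\beta\alpha}^*$ and $\widetilde Q_{\alpha\beta}|_{\mathcal H}=Q_{\alpha\beta}$, and a $\widetilde Q$-commuting family $\{U_\alpha:\alpha\in\Lambda\}$ of unitaries on $\mathcal K$, such that $$\prod_{1\le i<j\le k}Q_{\alpha_i\alpha_j}^{-m_i^+m_j^-}\,\bigl[(T_{\alpha_1}^{m_1^-})^*\cdots(T_{\alpha_k}^{m_k^-})^*\bigr]\bigl[T_{\alpha_1}^{m_1^+}\cdots T_{\alpha_k}^{m_k^+}\bigr]=P_{\mathcal H}\,U_{\alpha_1}^{m_1}\cdots U_{\alpha_k}^{m_k}\big|_{\mathcal H}$$ for all $k\ge 0$, all pairwise distinct $\alpha_1,\dots,\alpha_k\in\Lambda$ and all $m_1,\dots,m_k\in\mathbb Z$. **Theorem.** Let $\mathcal T=\{T_\alpha:\alpha\in\Lambda\}$ be a $Q$-commuting family of contractions on $\mathcal H$. Then $\mathcal T$ admits a regular $Q$-unitary dilation if and only if $$S(u)=\sum_{\{\alpha_1,\dots,\alpha_m\}\subseteq u}(-1)^m(T_{\alpha_1}\cdots T_{\alpha_m})^*(T_{\alpha_1}\cdots T_{\alpha_m})\ge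 0$$ for every finite subset $u$ of $\Lambda$ (each summand is independent of the order of its factors). Moreover, $\mathcal T$ admits a regular $Q$-unitary dilation in each of the following cases: 1. every $T_\alpha$ is an isometry; 2. $\mathcal T$ is doubly $Q$-commuting; 3. $\Lambda$ is countable and $\sum_{\alpha\in\Lambda}\|T_\alpha\|^2\le 1$. -/

import Mathlib

universe u v

namespace QDilation

section

variable {Λ : Type v} {H : Type u} [NormedAddCommGroup H] [InnerProductSpace ℂ H] [CompleteSpace H]

/-- The family `T` of bounded operators is `Q`-commuting via the family `Q = (Q α β)`, `α ≠ β`, of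
commuting unitaries. The diagonal entries `Q α α` play no role. -/
structure IsQCommuting (Q : Λ → Λ → H →L[ℂ] H) (T : Λ → H →L[ℂ] H) : Prop where
  unitary_mem : ∀ α β, α ≠ β → Q α β ∈ unitary (H →L[ℂ] H)
  symm : ∀ α β, α ≠ β → Q α β = star (Q β α)
  comm : ∀ α β γ δ, α ≠ β → γ ≠ δ → Q α β * Q γ δ = Q γ δ * Q α β
  comm_right : ∀ α β k, α ≠ β → T k * Q α β = Q α β * T k
  rel : ∀ α β, α ≠ β → T α * T β = Q α β * (T β * T α)

/-- `T` is doubly `Q`-commuting. -/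
structure IsDoublyQCommuting (Q : Λ → Λ → H →L[ℂ] H) (T : Λ → H →L[ℂ] H) : Prop
    extends IsQCommuting Q T where
  rel_star : ∀ α β, α ≠ β → T α * star (T β) = star (Q α β) * (star (T β) * T α)

/-- The ordered product `∏_{i<j} Q_{α_i α_j}^{-m_i⁺ m_j⁻}`; here `m⁺ = m.toNat`,
`m⁻ = (-m).toNat`, and `Q⁻¹ = Q*` since `Q` is unitary. -/
noncomputable def phase (Q : Λ → Λ → H →L[ℂ] H) {k : ℕ} (α : Fin k → Λ) (m : Fin k → ℤ) : H →L[ℂ] H :=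
  (List.ofFn fun i : Fin k => (List.ofFn fun j : Fin k =>
    if i < j then star (Q (α i) (α j)) ^ ((m i).toNat * (-m j).toNat) else 1).prod).prod

/-- `∏_{i<j} Q_{α_i α_j}^{-m_i⁺ m_j⁻} [(T_{α_1}^{m_1⁻})* ⋯ (T_{α_k}^{m_k⁻})*]
[T_{α_1}^{m_1⁺} ⋯ T_{α_k}^{m_k⁺}]`. -/
noncomputable def regularProduct (Q : Λ → Λ → H →L[ℂ] H) (T : Λ → H →L[ℂ] H) {k : ℕ}
    (α : Fin k → Λ) (m : Fin k → ℤ) : H →L[ℂ] H :=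
  phase Q α m *
    (List.ofFn fun i : Fin k => star (T (α i) ^ (-m i).toNat)).prod *
    (List.ofFn fun i : Fin k => T (α i) ^ (m i).toNat).prod

/-- `T` has a regular `Q`-unitary dilation: the inclusion `H ⊆ K` is an isometric embedding `ι`, so
that `P_H A|_H = ι* A ι`; the unitaries `U α` on `K` are `Q`-commuting, where `Q` acts on `K`
through a family `Q'` of commuting unitaries whose members restrict on `H` to those of `Q`. -/
def HasRegularQUnitaryDilation (Q : Λ → Λ → H →L[ℂ] H) (T : Λ → H →L[ℂ] H) : Prop :=
  ∃ (K : Type (max u v)) (_ : NormedAddCommGroup K) (_ : InnerProductSpace ℂ K)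
    (_ : CompleteSpace K) (ι : H →ₗᵢ[ℂ] K) (Q' : Λ → Λ → K →L[ℂ] K)
    (U : Λ → unitary (K →L[ℂ] K)),
    IsQCommuting Q' (fun α => (U α : K →L[ℂ] K)) ∧
    (∀ α β, α ≠ β → ∀ h : H, Q' α β (ι h) = ι (Q α β h)) ∧
    ∀ (k : ℕ) (α : Fin k → Λ), Function.Injective α → ∀ m : Fin k → ℤ,
      regularProduct Q T α m =
        (ContinuousLinearMap.adjoint ι.toContinuousLinearMap) ∘L
          ((List.ofFn fun i : Fin k => U (α i) ^ m i).prod : unitary (K →L[ℂ] K)).1 ∘L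
          ι.toContinuousLinearMap

/-- The product `T_{α_1} ⋯ T_{α_m}` over `v = {α_1, …, α_m}` in some enumeration of `v`. -/
noncomputable def setProd (T : Λ → H →L[ℂ] H) (v : Finset Λ) : H →L[ℂ] H :=
  (v.toList.map T).prod

/-- `S(u) = ∑_{v ⊆ u} (-1)^{|v|} (T_v)* T_v`. -/
noncomputable def brehmerSum (T : Λ → H →L[ℂ] H) (u : Finset Λ) : H →L[ℂ] H :=
  ∑ v ∈ u.powerset, (-1 : ℂ) ^ v.card • (star (setProd T v) * setProd T v)

/-- Brehmer's positivity condition. -/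
def BrehmerPositive (T : Λ → H →L[ℂ] H) : Prop :=
  ∀ u : Finset Λ, (brehmerSum T u).IsPositive

theorem IsQCommuting.exists_of_perm {Q : Λ → Λ → H →L[ℂ] H} {T : Λ → H →L[ℂ] H}
    (hT : IsQCommuting Q T) {l₁ l₂ : List Λ} (h : l₁.Perm l₂) :
    ∃ W ∈ unitary (H →L[ℂ] H), (∀ k, T k * W = W * T k) ∧
      (l₁.map T).prod = W * (l₂.map T).prod := by
  induction h with
  | nil => exact ⟨1, one_mem _, by simp, by simp⟩
  | cons x _ ih =>
    obtain ⟨W, hW, hc, he⟩ := ih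
    exact ⟨W, hW, hc, by
      rw [List.map_cons, List.map_cons, List.prod_cons, List.prod_cons, he, ← mul_assoc, hc,
        mul_assoc]⟩
  | swap x y l =>
    by_cases hxy : y = x
    · subst hxy
      exact ⟨1, one_mem _, by simp, by simp⟩
    · refine ⟨Q y x, hT.unitary_mem _ _ hxy, fun k => hT.comm_right _ _ _ hxy, ?_⟩
      simp only [List.map_cons, List.prod_cons]
      rw [← mul_assoc, hT.rel _ _ hxy]
      simp only [mul_assoc]
  | trans _ _ ih₁ ih₂ =>
    obtain ⟨W₁, hW₁, hc₁, he₁⟩ := ih₁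
    obtain ⟨W₂, hW₂, hc₂, he₂⟩ := ih₂
    refine ⟨W₁ * W₂, mul_mem hW₁ hW₂, fun k => ?_, by rw [he₁, he₂, mul_assoc]⟩
    rw [← mul_assoc, hc₁, mul_assoc, hc₂, mul_assoc]

/-- The summands of `S(u)` do not depend on the enumeration used in `setProd`. -/
theorem IsQCommuting.star_setProd_mul_setProd {Q : Λ → Λ → H →L[ℂ] H} {T : Λ → H →L[ℂ] H}
    (hT : IsQCommuting Q T) (v : Finset Λ) {l : List Λ} (h : l.Perm v.toList) :
    star (setProd T v) * setProd T v = star (l.map T).prod * (l.map T).prod := by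
  obtain ⟨W, hW, -, he⟩ := hT.exists_of_perm h
  have hW' : star W * W = 1 := (Unitary.mem_iff.mp hW).1
  rw [he, star_mul, mul_assoc, ← mul_assoc (star W), hW', one_mul, setProd]

end

end QDilation

/-! Brehmer positivity gives a dilation. The operators `Q α β` generate a commutative group of
unitaries, written additively as `A` with character `ρ`. A bicharacter `B` on the multidegrees `Λ →₀
ℤ`, with values in `A`, records the cost of reordering letters, and `T` extends to the positive cone
with `T p * T q = ρ (B p q) * T (p + q)`. The regular kernel has entries `ρ (B (m ⊓ n) (m - n)) T(m
- m ⊓ n)* T(n - m ⊓ n)`. Telescoping one variable at a time gives `∑_{0 ≤ k ≤ l} T(l - k)* S(supp k)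
T(l - k) = 1`. Inserting this identity in the middle of each entry factors the kernel as `∑_k
F_k(m)* S(supp k) F_k(n)`, so Brehmer positivity makes it positive semidefinite
(`regularKernel_eq_sum`, `posSemidef_regularKernel`).

A positive kernel is the Gram kernel of a total family `E n`. Translations `E n ↦ E (n + a)`,
corrected by a phase, and multiplication by phases preserve the Gram operators, so they define the
unitaries on the larger space, with `H` embedded by `E 0` (`TwistedRep.exists_dilation`). The
regular product of a `Q`-commuting family is a phase times an adjoint of a word times a word in
other letters, and the phase intertwines with the embedding.

Conversely, starting from the embedding `ι`, set `X_∅ = ι` and `X_{u ∪ {β}} = X_u - U_β* X_u T_β`.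
Then `X_u* X_u = S(u)`, which is therefore positive (`brehmerPositive_of_regular`).

The three special cases reduce to Brehmer positivity through `S(u ∪ {α}) = S(u) - T_α* S(u) T_α`. -/

open scoped InnerProductSpace ComplexOrder

namespace QDilation

/-! ### Isometries from equality of Gram operators. -/

section

variable {X : Type*} {H K K' : Type*} [NormedAddCommGroup H] [InnerProductSpace ℂ H]
  [NormedAddCommGroup K] [InnerProductSpace ℂ K]
  [NormedAddCommGroup K'] [InnerProductSpace ℂ K']

/-- The ranges of the operators `E x` span a dense subspace. -/
def IsTotal (E : X → H →L[ℂ] K) : Prop :=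
  Dense (Submodule.span ℂ {E x v | (x) (v)} : Set K)

theorem IsTotal.ext {E : X → H →L[ℂ] K} (hE : IsTotal E) {A B : K →L[ℂ] K'}
    (h : ∀ x, A ∘L E x = B ∘L E x) : A = B := by
  refine ContinuousLinearMap.ext_on hE ?_
  rintro _ ⟨x, v, rfl⟩
  exact congrArg (fun f : H →L[ℂ] K' => f v) (h x)

variable [CompleteSpace H] [CompleteSpace K] [CompleteSpace K']

/-- Two families of operators with the same Gram operators are related by an isometry, provided
the first one is total. -/
theorem IsTotal.exists_isometry {E : X → H →L[ℂ] K} (hE : IsTotal E) (F : X → H →L[ℂ] K')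
    (h : ∀ x y, (F x).adjoint ∘L F y = (E x).adjoint ∘L E y) :
    ∃ W : K →L[ℂ] K', W.adjoint ∘L W = 1 ∧ ∀ x, W ∘L E x = F x := by
  classical
  -- Both families are summed over finitely supported `H`-valued functions. Equal Gram operators
  -- give equal inner products, so `f` factors through the dense range of `e` and extends by
  -- continuity.
  let e : (X →₀ H) →ₗ[ℂ] K := Finsupp.lsum ℂ fun x => (E x).toLinearMap
  let f : (X →₀ H) →ₗ[ℂ] K' := Finsupp.lsum ℂ fun x => (F x).toLinearMap
  have he : DenseRange e := by
    refine hE.mono ?_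
    rw [← LinearMap.coe_range, SetLike.coe_subset_coe, Submodule.span_le]
    rintro _ ⟨x, v, rfl⟩
    exact ⟨Finsupp.single x v, by simp [e]⟩
  have hin : ∀ u v, ⟪f u, f v⟫_ℂ = ⟪e u, e v⟫_ℂ := by
    intro u v
    simp only [e, f, Finsupp.lsum_apply, Finsupp.sum, sum_inner, inner_sum]
    refine Finset.sum_congr rfl fun y _ => Finset.sum_congr rfl fun x _ => ?_
    have := congrArg (fun A : H →L[ℂ] H => ⟪A (u x), v y⟫_ℂ) (h y x)
    simpa [ContinuousLinearMap.adjoint_inner_left] using this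
  have hn : ∀ u, ‖f u‖ = ‖e u‖ := by
    intro u
    rw [← sq_eq_sq₀ (norm_nonneg _) (norm_nonneg _), ← inner_self_eq_norm_sq (𝕜 := ℂ),
      ← inner_self_eq_norm_sq (𝕜 := ℂ), hin]
  have hb : ∃ C, ∀ x, ‖f x‖ ≤ C * ‖e x‖ := ⟨1, fun u => by rw [hn, one_mul]⟩
  have hW : ∀ u, f.extendOfNorm e (e u) = f u := fun u => LinearMap.extendOfNorm_eq he hb u
  have hWE : ∀ x, f.extendOfNorm e ∘L E x = F x := by
    intro x
    ext v
    have := hW (Finsupp.single x v)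
    simpa [e, f] using this
  refine ⟨f.extendOfNorm e, hE.ext fun y => ?_, hWE⟩
  rw [ContinuousLinearMap.comp_assoc, hWE]
  refine ContinuousLinearMap.ext fun v => ?_
  refine he.eq_of_inner_right ℂ fun u => ?_
  rw [ContinuousLinearMap.comp_apply, ContinuousLinearMap.adjoint_inner_right, hW]
  have := hin u (Finsupp.single y v)
  simpa [e, f] using this

end

/-! ### Positivity of the regular kernel of a twisted cone representation. -/

section Kernel

variable {M A H : Type*} [AddCommGroup M] [Lattice M] [LocallyFiniteOrder M] [AddCommGroup A]
  [NormedAddCommGroup H] [InnerProductSpace ℂ H]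

theorem AddChar.commute_apply (ρ : AddChar A (H →L[ℂ] H)) (x y : A) : Commute (ρ x) (ρ y) := by
  rw [Commute, SemiconjBy, ← AddChar.map_add_eq_mul, ← AddChar.map_add_eq_mul, add_comm]

variable [CompleteSpace H]

/-- A positive cone representation of `M`, twisted by the bicharacter `B` with values in phases
`ρ`, that satisfies an abstract form of Brehmer's condition with positive operators `S k`. -/
structure TwistedRep (B : M →+ M →+ A) (ρ : AddChar A (H →L[ℂ] H)) (T S : M → H →L[ℂ] H) :
    Prop where
  star_phase : ∀ x, star (ρ x) = ρ (-x)
  comm : ∀ p x, Commute (T p) (ρ x)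
  apply_zero : T 0 = 1
  apply_mul : ∀ p q, 0 ≤ p → 0 ≤ q → T p * T q = ρ (B p q) * T (p + q)
  defect_comm : ∀ p x, Commute (S p) (ρ x)
  defect_nonneg : ∀ p, (S p).IsPositive
  sum_defect : ∀ l, 0 ≤ l → ∑ k ∈ Finset.Icc 0 l, star (T (l - k)) * S k * T (l - k) = 1

/-- The regular kernel. -/
noncomputable def regularKernel (B : M →+ M →+ A) (ρ : AddChar A (H →L[ℂ] H))
    (T : M → H →L[ℂ] H) : Matrix M M (H →L[ℂ] H) :=
  .of fun m n => ρ (B (m ⊓ n) (m - n)) * (star (T (m - m ⊓ n)) * T (n - m ⊓ n))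

variable {B : M →+ M →+ A} {ρ : AddChar A (H →L[ℂ] H)} {T S : M → H →L[ℂ] H}

namespace TwistedRep

theorem comm_star (h : TwistedRep B ρ T S) (p : M) (x : A) : Commute (star (T p)) (ρ x) := by
  have := (h.comm p (-x)).star_star
  rwa [h.star_phase, neg_neg] at this

theorem isHermitian_regularKernel (h : TwistedRep B ρ T S) :
    (regularKernel B ρ T).IsHermitian := by
  ext m n : 1
  simp only [Matrix.conjTranspose_apply, regularKernel, Matrix.of_apply, star_mul, star_star,
    h.star_phase, inf_comm n m]
  rw [← map_neg, neg_sub]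
  exact ((h.comm_star _ _).mul_left (h.comm _ _)).eq

/-- The factors of the regular kernel, for indices bounded below by `c`. -/
noncomputable def _root_.QDilation.kernelFactor [DecidableLE M] (B : M →+ M →+ A)
    (ρ : AddChar A (H →L[ℂ] H)) (T : M → H →L[ℂ] H) (c k n : M) : H →L[ℂ] H :=
  if k ≤ n - c then ρ (-B (c + k) n) * T (n - c - k) else 0

variable [IsOrderedAddMonoid M]

/-- A Cholesky-type factorization: the identity between `star (T (m - m ⊓ n))` and `T (n - m ⊓ n)`
is expanded by `sum_defect`, and each `T (m ⊓ n - c - k)` is absorbed on both sides. The resulting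
phase splits into a part depending on `m` and one depending on `n`. -/
theorem regularKernel_eq_sum [DecidableLE M] (h : TwistedRep B ρ T S) {c d m n : M}
    (hcm : c ≤ m) (hcn : c ≤ n) (hd : m - c ≤ d) :
    regularKernel B ρ T m n = ∑ k ∈ Finset.Icc 0 d,
      star (kernelFactor B ρ T c k m) * S k * kernelFactor B ρ T c k n := by
  set l := m ⊓ n with hl
  have hcl : c ≤ l := le_inf hcm hcn
  have hlm : l ≤ m := inf_le_left
  have hln : l ≤ n := inf_le_right
  have hsub : Finset.Icc 0 (l - c) ⊆ Finset.Icc 0 d :=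
    Finset.Icc_subset_Icc le_rfl ((sub_le_sub_right hlm c).trans hd)
  -- Only `k ≤ m ⊓ n - c` contributes: for any other `k`, one of the two factors is zero by the
  -- definition of `kernelFactor`.
  rw [← Finset.sum_subset hsub]
  · have h1 : regularKernel B ρ T m n = ρ (B l (m - n)) * (star (T (m - l)) *
        1 * T (n - l)) := by
      rw [mul_one]; rfl
    rw [h1, ← h.sum_defect (l - c) (sub_nonneg.2 hcl), Finset.mul_sum, Finset.sum_mul,
      Finset.mul_sum]
    refine Finset.sum_congr rfl fun k hk => ?_
    obtain ⟨hk0, hkl⟩ := Finset.mem_Icc.1 hk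
    have hkm : k ≤ m - c := hkl.trans (sub_le_sub_right hlm c)
    have hkn : k ≤ n - c := hkl.trans (sub_le_sub_right hln c)
    rw [kernelFactor, kernelFactor, if_pos hkm, if_pos hkn]
    have e1 : T (l - c - k) * T (n - l) = ρ (B (l - c - k) (n - l)) * T (n - c - k) := by
      rw [h.apply_mul _ _ (sub_nonneg.2 hkl) (sub_nonneg.2 hln)]
      congr 2; abel
    have e2 : T (l - c - k) * T (m - l) = ρ (B (l - c - k) (m - l)) * T (m - c - k) := by
      rw [h.apply_mul _ _ (sub_nonneg.2 hkl) (sub_nonneg.2 hlm)]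
      congr 2; abel
    have e3 := congrArg star e2
    rw [star_mul, star_mul, h.star_phase, (h.comm_star _ _).eq] at e3
    have e4 : ρ (B l (m - n)) * (star (T (m - l)) *
        (star (T (l - c - k)) * S k * T (l - c - k)) * T (n - l)) =
        ρ (B l (m - n)) * ((star (T (m - l)) * star (T (l - c - k))) * S k *
          (T (l - c - k) * T (n - l))) := by
      simp only [mul_assoc]
    rw [e4, e1, e3, star_mul, h.star_phase, neg_neg, (h.comm_star _ _).eq]
    have e5 : ∀ x y z : A, ∀ a b : H →L[ℂ] H, Commute a (ρ z) → Commute (S k) (ρ z) →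
        ρ x * (ρ y * a * S k * (ρ z * b)) = ρ (x + y + z) * (a * (S k * b)) := by
      intro x y z a b ha hS
      rw [AddChar.map_add_eq_mul, AddChar.map_add_eq_mul]
      simp only [mul_assoc]
      rw [hS.left_comm, ha.left_comm]
    have e6 := e5 0 (B (c + k) m) (-B (c + k) n) (star (T (m - c - k))) (T (n - c - k))
      (h.comm_star _ _) (h.defect_comm _ _)
    rw [AddChar.map_zero_eq_one, one_mul] at e6
    rw [e5 _ _ _ _ _ (h.comm_star _ _) (h.defect_comm _ _), e6]
    congr 2
    simp only [map_add, map_sub, AddMonoidHom.add_apply, AddMonoidHom.sub_apply, neg_sub]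
    abel
  · intro k hk hk'
    obtain ⟨hk0, hkd⟩ := Finset.mem_Icc.1 hk
    by_cases hkm : k ≤ m - c
    · have hkn : ¬ k ≤ n - c := fun hkn => hk' (Finset.mem_Icc.2 ⟨hk0, by
        rw [hl, le_sub_iff_add_le]
        exact le_inf (le_sub_iff_add_le.1 hkm) (le_sub_iff_add_le.1 hkn)⟩)
      rw [kernelFactor, kernelFactor, if_neg hkn, mul_zero]
    · rw [kernelFactor, if_neg hkm, star_zero, zero_mul, zero_mul]

/-- On a finite support one lower bound `c` serves all indices, so the factorization turns the
quadratic form into a sum of terms `⟪S k v, v⟫`. -/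
theorem posSemidef_regularKernel (h : TwistedRep B ρ T S) :
    (regularKernel B ρ T).PosSemidef := by
  classical
  have tfae := (RKHS.posSemidef_tfae (K := regularKernel B ρ T)).out 0 2
  refine tfae.2 ⟨h.isHermitian_regularKernel, fun f => ?_⟩
  rcases f.support.eq_empty_or_nonempty with hf | hf
  · rw [Finsupp.support_eq_empty.1 hf]; simp
  set c := f.support.inf' hf id
  set d := f.support.sup' hf id - c
  have hc : ∀ m ∈ f.support, c ≤ m := fun m hm => Finset.inf'_le id hm
  have hd : ∀ m ∈ f.support, m - c ≤ d := fun m hm =>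
    sub_le_sub_right (Finset.le_sup' id hm) c
  have key : (f.sum fun x w => f.sum fun x' w' => ⟪regularKernel B ρ T x' x w, w'⟫_ℂ) =
      ∑ k ∈ Finset.Icc 0 d,
        ⟪S k (∑ n ∈ f.support, kernelFactor B ρ T c k n (f n)),
          ∑ n ∈ f.support, kernelFactor B ρ T c k n (f n)⟫_ℂ := by
    simp only [Finsupp.sum, map_sum, sum_inner, inner_sum]
    rw [Finset.sum_comm (s := Finset.Icc 0 d)]
    rw [Finset.sum_comm]
    refine Finset.sum_congr rfl fun m hm => ?_
    rw [Finset.sum_comm (s := Finset.Icc 0 d)]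
    refine Finset.sum_congr rfl fun n hn => ?_
    rw [h.regularKernel_eq_sum (hc m hm) (hc n hn) (hd m hm)]
    rw [_root_.sum_apply, sum_inner]
    refine Finset.sum_congr rfl fun k _ => ?_
    rw [mul_assoc, mul_apply_eq_comp, ContinuousLinearMap.star_eq_adjoint,
      ContinuousLinearMap.adjoint_inner_left]
    rfl
  rw [key, map_sum]
  exact Finset.sum_nonneg fun k _ => (h.defect_nonneg k).re_inner_nonneg_left _

end TwistedRep

end Kernel

/-! ### Unitary dilation of a twisted cone representation. -/

section Dilation

theorem mem_unitary_of_isometry {K : Type*} [NormedAddCommGroup K] [InnerProductSpace ℂ K]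
    [CompleteSpace K] {W Y : K →L[ℂ] K} (h : star W * W = 1) (hY : W * Y = 1) :
    W ∈ unitary (K →L[ℂ] K) := by
  have : star W = Y := by
    rw [← mul_one (star W), ← hY, ← mul_assoc, h, one_mul]
  exact Unitary.mem_iff.2 ⟨h, this ▸ hY⟩

/-- A total family with prescribed positive semidefinite Gram operators. -/
theorem exists_isTotal_of_posSemidef {X : Type v} {H : Type u} [NormedAddCommGroup H]
    [InnerProductSpace ℂ H] [CompleteSpace H] (G : Matrix X X (H →L[ℂ] H)) (hG : G.PosSemidef) :
    ∃ (K : Type (max u v)) (_ : NormedAddCommGroup K) (_ : InnerProductSpace ℂ K)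
      (_ : CompleteSpace K) (E : X → H →L[ℂ] K), IsTotal E ∧
      ∀ m n, (E m).adjoint ∘L E n = G m n := by
  have : Fact G.PosSemidef := ⟨hG⟩
  refine ⟨RKHS.OfKernel G, inferInstance, inferInstance, inferInstance,
    RKHS.kerFun (RKHS.OfKernel G), ?_, fun m n => ?_⟩
  · have := RKHS.kerFun_dense (RKHS.OfKernel G)
    exact Submodule.dense_iff_topologicalClosure_eq_top.2 this
  · rw [← RKHS.kernel_apply, RKHS.OfKernel.kernel_ofKernel]

variable {M : Type v} {A : Type*} {H : Type u} [AddCommGroup M] [Lattice M]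
  [LocallyFiniteOrder M] [AddCommGroup A]
  [NormedAddCommGroup H] [InnerProductSpace ℂ H] [CompleteSpace H]
  {B : M →+ M →+ A} {ρ : AddChar A (H →L[ℂ] H)} {T S : M → H →L[ℂ] H}

/-- This invariance is what extends the phases `ρ x` from `H` to the dilation space. -/
theorem TwistedRep.phase_regularKernel (h : TwistedRep B ρ T S) (x : A) (m n : M) :
    star (ρ x) * regularKernel B ρ T m n * ρ x = regularKernel B ρ T m n := by
  simp only [regularKernel, Matrix.of_apply]
  rw [mul_assoc, mul_assoc, ((h.comm_star _ _).mul_left (h.comm _ _)).eq, ← mul_assoc,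
    ← mul_assoc, h.star_phase, ← AddChar.map_add_eq_mul, ← AddChar.map_add_eq_mul]
  congr 2
  abel

variable [IsOrderedAddMonoid M]

/-- Translation by `a` fixes the differences and multiplies the entry by `ρ (B a (m - n))`. That
phase splits into a factor for `m` and one for `n`, which is why translations become isometries once
corrected by `ρ (B a n)`. -/
theorem TwistedRep.regularKernel_add (h : TwistedRep B ρ T S) (a m n : M) :
    star (ρ (B a m)) * regularKernel B ρ T (m + a) (n + a) * ρ (B a n) =
      regularKernel B ρ T m n := by
  have e1 : m + a - (m + a) ⊓ (n + a) = m - m ⊓ n := by rw [← inf_add]; abel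
  have e2 : n + a - (m + a) ⊓ (n + a) = n - m ⊓ n := by rw [← inf_add]; abel
  simp only [regularKernel, Matrix.of_apply, e1, e2]
  rw [mul_assoc, mul_assoc, ((h.comm_star _ _).mul_left (h.comm _ _)).eq, ← mul_assoc,
    ← mul_assoc, h.star_phase, ← AddChar.map_add_eq_mul, ← AddChar.map_add_eq_mul, ← inf_add]
  congr 2
  simp only [map_add, map_sub, AddMonoidHom.add_apply]
  abel

/-- A twisted representation with positive defects dilates to a twisted representation of the
whole group by unitaries. -/
theorem TwistedRep.exists_dilation (h : TwistedRep B ρ T S) :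
    ∃ (K : Type (max u v)) (_ : NormedAddCommGroup K) (_ : InnerProductSpace ℂ K)
      (_ : CompleteSpace K) (ι : H →ₗᵢ[ℂ] K) (σ : AddChar A (K →L[ℂ] K)) (U : M → K →L[ℂ] K),
      (∀ x, star (σ x) = σ (-x)) ∧ (∀ a, U a ∈ unitary (K →L[ℂ] K)) ∧
      (∀ a x, Commute (U a) (σ x)) ∧ (∀ a b, U a * U b = σ (B a b) * U (a + b)) ∧ U 0 = 1 ∧
      (∀ x v, σ x (ι v) = ι (ρ x v)) ∧
      ∀ p q, p ⊓ q = 0 → ι.toContinuousLinearMap.adjoint ∘L (star (U q) * U p) ∘L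
        ι.toContinuousLinearMap = star (T q) * T p := by
  obtain ⟨K, _, _, _, E, hE, hG⟩ := exists_isTotal_of_posSemidef _ h.posSemidef_regularKernel
  have hU : ∀ a : M, ∃ W : K →L[ℂ] K, W.adjoint ∘L W = 1 ∧
      ∀ n, W ∘L E n = E (n + a) ∘L ρ (B a n) := fun a =>
    hE.exists_isometry _ fun m n => by
      rw [hG, ← h.regularKernel_add a m n, ← hG, ContinuousLinearMap.adjoint_comp]
      rfl
  have hσ : ∀ x : A, ∃ W : K →L[ℂ] K, W.adjoint ∘L W = 1 ∧ ∀ n, W ∘L E n = E n ∘L ρ x := fun x =>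
    hE.exists_isometry _ fun m n => by
      rw [hG, ← h.phase_regularKernel x m n, ← hG, ContinuousLinearMap.adjoint_comp]
      rfl
  choose U hUi hUE using hU
  choose s hsi hsE using hσ
  have s_zero : s 0 = 1 := hE.ext fun n => by
    rw [hsE, AddChar.map_zero_eq_one]; rfl
  have s_add : ∀ x y, s (x + y) = s x * s y := fun x y => hE.ext fun n => by
    rw [ContinuousLinearMap.mul_def, ContinuousLinearMap.comp_assoc, hsE, hsE,
      ← ContinuousLinearMap.comp_assoc, hsE, AddChar.map_add_eq_mul]
    rfl
  have U_mul : ∀ a b, U a * U b = s (B a b) * U (a + b) := fun a b => hE.ext fun n => by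
    rw [ContinuousLinearMap.mul_def, ContinuousLinearMap.mul_def, ContinuousLinearMap.comp_assoc,
      ContinuousLinearMap.comp_assoc, hUE, hUE, ← ContinuousLinearMap.comp_assoc,
      ← ContinuousLinearMap.comp_assoc, hUE, hsE, ContinuousLinearMap.comp_assoc,
      ContinuousLinearMap.comp_assoc, ← ContinuousLinearMap.mul_def,
      ← ContinuousLinearMap.mul_def, ← AddChar.map_add_eq_mul, ← AddChar.map_add_eq_mul]
    congr 2
    · abel
    · simp only [map_add, AddMonoidHom.add_apply]
      abel
  have U_zero : U 0 = 1 := hE.ext fun n => by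
    rw [hUE, map_zero B, AddMonoidHom.zero_apply, AddChar.map_zero_eq_one, add_zero]
    rfl
  have U_comm : ∀ a x, Commute (U a) (s x) := fun a x => hE.ext fun n => by
    rw [ContinuousLinearMap.mul_def, ContinuousLinearMap.mul_def, ContinuousLinearMap.comp_assoc,
      ContinuousLinearMap.comp_assoc, hUE, hsE, ← ContinuousLinearMap.comp_assoc,
      ← ContinuousLinearMap.comp_assoc, hUE, hsE, ContinuousLinearMap.comp_assoc,
      ContinuousLinearMap.comp_assoc, ← ContinuousLinearMap.mul_def,
      ← ContinuousLinearMap.mul_def, (AddChar.commute_apply ρ _ _).eq]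
  have s_star : ∀ x, star (s x) = s (-x) := fun x => by
    have h1 : s x * s (-x) = 1 := by rw [← s_add, add_neg_cancel, s_zero]
    have h2 : star (s x) * s x = 1 := hsi x
    rw [← mul_one (star (s x)), ← h1, ← mul_assoc, h2, one_mul]
  -- The relation `U_mul` for `a` and `-a` exhibits a right inverse of the isometry `U a`.
  have U_unitary : ∀ a, U a ∈ unitary (K →L[ℂ] K) := fun a => by
    refine mem_unitary_of_isometry (Y := U (-a) * s (-B a (-a))) (hUi a) ?_
    rw [← mul_assoc, U_mul, add_neg_cancel, U_zero, mul_one, ← s_add, add_neg_cancel, s_zero]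
  have hE0 : (E 0).adjoint ∘L E 0 = 1 := by
    rw [hG, regularKernel, Matrix.of_apply]
    simp [h.apply_zero]
  let ι : H →ₗᵢ[ℂ] K := ⟨(E 0).toLinearMap, fun v => by
    rw [← sq_eq_sq₀ (norm_nonneg _) (norm_nonneg _), ← inner_self_eq_norm_sq (𝕜 := ℂ),
      ← inner_self_eq_norm_sq (𝕜 := ℂ), ContinuousLinearMap.coe_coe,
      ← ContinuousLinearMap.adjoint_inner_left]
    have := congrArg (fun f : H →L[ℂ] H => f v) hE0
    rw [show (E 0).adjoint (E 0 v) = v from this]⟩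
  have hι : ι.toContinuousLinearMap = E 0 := rfl
  have hUE0 : ∀ a, U a ∘L E 0 = E a := fun a => by
    rw [hUE, map_zero (B a), AddChar.map_zero_eq_one, zero_add]
    rfl
  refine ⟨K, inferInstance, inferInstance, inferInstance, ι, ⟨s, s_zero, s_add⟩, U, s_star,
    U_unitary, U_comm, U_mul, U_zero, fun x v => ?_, fun p q hpq => ?_⟩
  · exact congrArg (fun f : H →L[ℂ] K => f v) (hsE x 0)
  · have e : (E 0).adjoint ∘L (star (U q) * U p) ∘L E 0 =
        (U q ∘L E 0).adjoint ∘L (U p ∘L E 0) := by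
      rw [ContinuousLinearMap.adjoint_comp]; rfl
    rw [hι, e, hUE0, hUE0, hG, regularKernel, Matrix.of_apply, inf_comm, hpq]
    simp

end Dilation

/-! ### Multidegrees of words and their reordering phases. -/

section Degree

variable {Λ A : Type*} [AddCommGroup A]

/-- The multidegree of a word. -/
noncomputable def wordDegree (l : List Λ) : Λ →₀ ℤ := (l.map fun α => Finsupp.single α 1).sum

@[simp]
theorem wordDegree_nil : wordDegree ([] : List Λ) = 0 := rfl

@[simp]
theorem wordDegree_cons (α : Λ) (l : List Λ) :
    wordDegree (α :: l) = Finsupp.single α 1 + wordDegree l := by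
  simp [wordDegree]

theorem wordDegree_append (l₁ l₂ : List Λ) :
    wordDegree (l₁ ++ l₂) = wordDegree l₁ + wordDegree l₂ := by
  simp [wordDegree]

theorem wordDegree_apply [DecidableEq Λ] (l : List Λ) (α : Λ) :
    wordDegree l α = l.count α := by
  induction l with
  | nil => simp
  | cons β l ih =>
    rw [wordDegree_cons, Finsupp.add_apply, ih, List.count_cons, Finsupp.single_apply]
    by_cases h : β = α
    · simp [h, add_comm]
    · simp [h]

theorem perm_of_wordDegree_eq {l₁ l₂ : List Λ} (h : wordDegree l₁ = wordDegree l₂) :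
    l₁.Perm l₂ := by
  classical
  rw [List.perm_iff_count]
  intro α
  have := DFunLike.congr_fun h α
  rw [wordDegree_apply, wordDegree_apply] at this
  exact_mod_cast this

theorem wordDegree_inf_eq_zero {l₁ l₂ : List Λ} (h : l₁.Disjoint l₂) :
    wordDegree l₁ ⊓ wordDegree l₂ = 0 := by
  classical
  ext α
  rw [Finsupp.inf_apply, wordDegree_apply, wordDegree_apply, Finsupp.zero_apply]
  by_cases h1 : α ∈ l₁
  · rw [List.count_eq_zero_of_not_mem (h h1)]
    simp
  · rw [List.count_eq_zero_of_not_mem h1]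
    simp

theorem wordDegree_replicate (n : ℕ) (α : Λ) :
    wordDegree (List.replicate n α) = Finsupp.single α (n : ℤ) := by
  simp [wordDegree]

theorem exists_wordDegree_eq (n : Λ →₀ ℤ) (hn : 0 ≤ n) : ∃ l : List Λ, wordDegree l = n := by
  classical
  induction n using Finsupp.induction with
  | zero => exact ⟨[], rfl⟩
  | single_add a b f ha _ ih =>
    have hf : 0 ≤ f := by
      intro c
      by_cases hc : c = a
      · subst hc
        rw [Finsupp.notMem_support_iff.1 ha]
        rfl
      · simpa [Finsupp.single_apply, Ne.symm hc] using hn c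
    have hb : 0 ≤ b := by simpa [Finsupp.notMem_support_iff.1 ha] using hn a
    obtain ⟨l, hl⟩ := ih hf
    lift b to ℕ using hb
    exact ⟨List.replicate b a ++ l, by rw [wordDegree_append, wordDegree_replicate, hl]⟩

/-- The bicharacter with values `b α β` on the standard generators. -/
noncomputable def bicharacter (b : Λ → Λ → A) : (Λ →₀ ℤ) →+ (Λ →₀ ℤ) →+ A :=
  Finsupp.liftAddHom fun α => zmultiplesHom _ (Finsupp.liftAddHom fun β => zmultiplesHom A (b α β))

@[simp]
theorem bicharacter_single (b : Λ → Λ → A) (α β : Λ) :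
    bicharacter b (Finsupp.single α 1) (Finsupp.single β 1) = b α β := by
  simp [bicharacter]

/-- The phase that relates a word to the normal form of its degree. -/
noncomputable def wordPhase (b : Λ → Λ → A) : List Λ → A
  | [] => 0
  | α :: l => wordPhase b l + bicharacter b (Finsupp.single α 1) (wordDegree l)

theorem wordPhase_append (b : Λ → Λ → A) (l₁ l₂ : List Λ) :
    wordPhase b (l₁ ++ l₂) =
      wordPhase b l₁ + wordPhase b l₂ + bicharacter b (wordDegree l₁) (wordDegree l₂) := by
  induction l₁ with
  | nil => simp [wordPhase]
  | cons α l ih =>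
    rw [List.cons_append, wordPhase, ih, wordPhase, wordDegree_append, wordDegree_cons, map_add,
      map_add, AddMonoidHom.add_apply]
    abel

end Degree

/-! ### Extension of the generators to the positive cone. -/

section Lift

variable {Λ A H : Type*} [AddCommGroup A] [NormedAddCommGroup H] [InnerProductSpace ℂ H]

/-- The extension of the generators `T` to a twisted representation of the positive cone. -/
noncomputable def liftRep (b : Λ → Λ → A) (ρ : AddChar A (H →L[ℂ] H)) (T : Λ → H →L[ℂ] H)
    (n : Λ →₀ ℤ) : H →L[ℂ] H :=
  open Classical in
  if h : ∃ l : List Λ, wordDegree l = n then ρ (-wordPhase b h.choose) * (h.choose.map T).prod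
  else 0

variable {b : Λ → Λ → A} {ρ : AddChar A (H →L[ℂ] H)} {T : Λ → H →L[ℂ] H}

theorem commute_prod_map {c : H →L[ℂ] H} (hc : ∀ α, Commute (T α) c) (l : List Λ) :
    Commute (l.map T).prod c :=
  Commute.list_prod_left _ _ fun x hx => by
    obtain ⟨α, -, rfl⟩ := List.mem_map.1 hx
    exact hc α

/-- Adjacent swaps generate all permutations, and `hb` says that a swap does not change the
normalized product. Hence `liftRep` does not depend on the chosen word. -/
theorem phase_mul_prod_of_perm (hc : ∀ α x, Commute (T α) (ρ x))
    (hb : ∀ α β, α ≠ β → ρ (-b α β) * (T α * T β) = ρ (-b β α) * (T β * T α))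
    {l₁ l₂ : List Λ} (h : l₁.Perm l₂) :
    ρ (-wordPhase b l₁) * (l₁.map T).prod = ρ (-wordPhase b l₂) * (l₂.map T).prod := by
  have hdeg : ∀ {l₁ l₂ : List Λ}, l₁.Perm l₂ → wordDegree l₁ = wordDegree l₂ := fun h =>
    (h.map _).sum_eq
  induction h with
  | nil => rfl
  | cons α h ih =>
    have key : ∀ (x y : A) (P : H →L[ℂ] H),
        ρ (-(x + y)) * (T α * P) = ρ (-y) * (T α * (ρ (-x) * P)) := fun x y P => by
      rw [neg_add_rev, AddChar.map_add_eq_mul, mul_assoc, (hc α _).left_comm]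
    simp only [wordPhase, List.map_cons, List.prod_cons]
    rw [key, key, ih, hdeg h]
  | swap β α l =>
    by_cases hαβ : α = β
    · rw [hαβ]
    · have key : ∀ (x y z w : A) (P R L : H →L[ℂ] H),
          ρ (-(x + y + (z + w))) * (P * (R * L)) =
            ρ (-(x + (y + w))) * ((ρ (-z) * (P * R)) * L) := fun x y z w P R L => by
        simp only [← mul_assoc]
        rw [← AddChar.map_add_eq_mul]
        congr 4
        abel
      simp only [wordPhase, List.map_cons, List.prod_cons, wordDegree_cons, map_add,
        bicharacter_single]
      rw [key, key, hb α β hαβ, add_comm (bicharacter b (Finsupp.single α 1) (wordDegree l))]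
  | trans _ _ ih₁ ih₂ => rw [ih₁, ih₂]

variable (hc : ∀ α x, Commute (T α) (ρ x))
  (hb : ∀ α β, α ≠ β → ρ (-b α β) * (T α * T β) = ρ (-b β α) * (T β * T α))

include hc in
theorem liftRep_commute (n : Λ →₀ ℤ) (x : A) : Commute (liftRep b ρ T n) (ρ x) := by
  rw [liftRep]
  split_ifs with h
  · exact (AddChar.commute_apply ρ _ _).mul_left (commute_prod_map (fun α => hc α x) _)
  · exact Commute.zero_left _

include hc hb

theorem prod_map_eq_liftRep (l : List Λ) :
    (l.map T).prod = ρ (wordPhase b l) * liftRep b ρ T (wordDegree l) := by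
  have h : ∃ l' : List Λ, wordDegree l' = wordDegree l := ⟨l, rfl⟩
  rw [liftRep, dif_pos h, phase_mul_prod_of_perm hc hb (perm_of_wordDegree_eq h.choose_spec),
    ← mul_assoc, ← AddChar.map_add_eq_mul, add_neg_cancel, AddChar.map_zero_eq_one, one_mul]

theorem liftRep_wordDegree (l : List Λ) :
    liftRep b ρ T (wordDegree l) = ρ (-wordPhase b l) * (l.map T).prod := by
  rw [prod_map_eq_liftRep hc hb, ← mul_assoc, ← AddChar.map_add_eq_mul, neg_add_cancel,
    AddChar.map_zero_eq_one, one_mul]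

theorem liftRep_zero : liftRep b ρ T 0 = 1 := by
  have := liftRep_wordDegree hc hb []
  simpa [wordPhase] using this

theorem liftRep_single (α : Λ) : liftRep b ρ T (Finsupp.single α 1) = T α := by
  have := liftRep_wordDegree hc hb [α]
  simpa [wordPhase] using this

theorem liftRep_mul {p q : Λ →₀ ℤ} (hp : 0 ≤ p) (hq : 0 ≤ q) :
    liftRep b ρ T p * liftRep b ρ T q = ρ (bicharacter b p q) * liftRep b ρ T (p + q) := by
  obtain ⟨l₁, rfl⟩ := exists_wordDegree_eq p hp
  obtain ⟨l₂, rfl⟩ := exists_wordDegree_eq q hq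
  rw [← wordDegree_append, liftRep_wordDegree hc hb, liftRep_wordDegree hc hb,
    liftRep_wordDegree hc hb, List.map_append, List.prod_append, wordPhase_append, mul_assoc,
    (commute_prod_map (fun α => hc α _) l₁).left_comm]
  simp only [← mul_assoc]
  rw [← AddChar.map_add_eq_mul, ← AddChar.map_add_eq_mul]
  congr 3
  abel

end Lift

/-! ### Brehmer sums as defects of the lifted representation. -/

section Brehmer

variable {Λ : Type v} {H : Type u} [NormedAddCommGroup H] [InnerProductSpace ℂ H]
  [CompleteSpace H] {Q : Λ → Λ → H →L[ℂ] H} {T : Λ → H →L[ℂ] H}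

theorem brehmerSum_commute {c : H →L[ℂ] H} (h : ∀ α, Commute (T α) c)
    (h' : ∀ α, Commute (T α) (star c)) (u : Finset Λ) : Commute (brehmerSum T u) c := by
  refine Commute.sum_left _ _ _ fun v _ => Commute.smul_left ?_ _
  have h1 : Commute (setProd T v) c := commute_prod_map h _
  have h2 : Commute (setProd T v) (star c) := commute_prod_map h' _
  have h3 := h2.star_star
  rw [star_star] at h3
  exact h3.mul_left h1

@[simp]
theorem brehmerSum_empty : brehmerSum T ∅ = 1 := by
  simp [brehmerSum, setProd]

/-- Subsets containing `α` are enumerated with `α` last, so that `T α` ends up outermost in `(T_v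
T_α)* (T_v T_α)`. -/
theorem IsQCommuting.brehmerSum_insert [DecidableEq Λ] (hT : IsQCommuting Q T) {α : Λ}
    {u : Finset Λ} (hα : α ∉ u) :
    brehmerSum T (insert α u) = brehmerSum T u - star (T α) * brehmerSum T u * T α := by
  rw [brehmerSum, Finset.sum_powerset_insert hα, sub_eq_add_neg, brehmerSum]
  congr 1
  rw [Finset.mul_sum, Finset.sum_mul, ← Finset.sum_neg_distrib]
  refine Finset.sum_congr rfl fun v hv => ?_
  have hv' : α ∉ v := fun h => hα (Finset.mem_powerset.1 hv h)
  have hp : (v.toList ++ [α]).Perm (insert α v).toList :=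
    (List.perm_append_singleton α v.toList).trans (Finset.toList_insert hv').symm
  rw [hT.star_setProd_mul_setProd _ hp, Finset.card_insert_of_notMem hv', List.map_append,
    List.prod_append, star_mul, pow_succ]
  simp [setProd, mul_assoc]

/-- The phases generated by the operators `Q α β` form a commutative group. -/
theorem IsQCommuting.exists_phases (hT : IsQCommuting Q T) :
    ∃ (A : Type u) (_ : AddCommGroup A) (ρ : AddChar A (H →L[ℂ] H)) (q : Λ → Λ → A),
      (∀ x, star (ρ x) = ρ (-x)) ∧ (∀ α x, Commute (T α) (ρ x)) ∧
      (∀ α β, α ≠ β → ρ (q α β) = Q α β) ∧ ∀ α β, α ≠ β → q α β = -q β α := by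
  classical
  let s : Set (unitary (H →L[ℂ] H)) := {w | ∃ α β, α ≠ β ∧ (w : H →L[ℂ] H) = Q α β}
  have hs : ∀ x ∈ s, ∀ y ∈ s, x * y = y * x := by
    rintro x ⟨α, β, h, hx⟩ y ⟨γ, δ, h', hy⟩
    ext1
    rw [Submonoid.coe_mul, Submonoid.coe_mul, hx, hy, hT.comm _ _ _ _ h h']
  let _ : CommGroup (Subgroup.closure s) :=
    { (inferInstance : Group (Subgroup.closure s)) with
      mul_comm := (Subgroup.isMulCommutative_closure hs).is_comm.comm }
  let w : ∀ α β, α ≠ β → Subgroup.closure s := fun α β h =>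
    ⟨⟨Q α β, hT.unitary_mem _ _ h⟩, Subgroup.subset_closure ⟨α, β, h, rfl⟩⟩
  have hstar : ∀ x : Subgroup.closure s,
      star ((x : unitary (H →L[ℂ] H)) : H →L[ℂ] H) = ((x⁻¹ : Subgroup.closure s) :
        unitary (H →L[ℂ] H)) := fun x => rfl
  refine ⟨Additive (Subgroup.closure s), inferInstance,
    ⟨fun x => ((x.toMul : unitary (H →L[ℂ] H)) : H →L[ℂ] H), rfl, fun _ _ => rfl⟩,
    fun α β => if h : α ≠ β then Additive.ofMul (w α β h) else 0, fun x => rfl, ?_, ?_, ?_⟩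
  · intro α x
    obtain ⟨x, hx⟩ := x
    change Commute (T α) (x : H →L[ℂ] H)
    induction hx using Subgroup.closure_induction with
    | mem x hx =>
      obtain ⟨β, γ, h, hx⟩ := hx
      rw [hx]
      exact hT.comm_right _ _ _ h
    | one => exact Commute.one_right _
    | mul x y _ _ hx hy => exact hx.mul_right hy
    | inv x _ hx =>
      have h1 : ((x : H →L[ℂ] H)) * ((x⁻¹ : unitary (H →L[ℂ] H)) : H →L[ℂ] H) = 1 := by
        rw [← Submonoid.coe_mul, mul_inv_cancel]; rfl
      have h2 : ((x⁻¹ : unitary (H →L[ℂ] H)) : H →L[ℂ] H) * (x : H →L[ℂ] H) = 1 := by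
        rw [← Submonoid.coe_mul, inv_mul_cancel]; rfl
      exact Commute.units_inv_right
        (u := ⟨(x : H →L[ℂ] H), ((x⁻¹ : unitary (H →L[ℂ] H)) : H →L[ℂ] H), h1, h2⟩) hx
  · intro α β h
    simp only [dif_pos h]
    rfl
  · intro α β h
    simp only [dif_pos h, dif_pos h.symm]
    rw [← ofMul_inv]
    congr 1
    ext1
    ext1
    exact hT.symm α β h

variable {A : Type*} [AddCommGroup A] {ρ : AddChar A (H →L[ℂ] H)} {b : Λ → Λ → A}

/-- Telescoping in one variable. -/
theorem sum_defect_single {R : Type*} [AddCommGroup R] (W : ℕ → R →+ R) (hW0 : W 0 = .id R)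
    (x : R) (hx : ∀ n, W (n + 1) x = W 1 (W n x))
    (hx' : ∀ n, W (n + 1) (x - W 1 x) = W 1 (W n (x - W 1 x))) (n : ℕ) :
    ∑ j ∈ Finset.range (n + 1), W (n - j) (if j = 0 then x else x - W 1 x) = x := by
  induction n with
  | zero => simp [hW0]
  | succ n ih =>
    rw [Finset.sum_range_succ, Nat.sub_self, hW0, if_neg (Nat.succ_ne_zero n)]
    have : ∑ j ∈ Finset.range (n + 1), W (n + 1 - j) (if j = 0 then x else x - W 1 x) = W 1 x := by
      conv_rhs => rw [← ih, map_sum]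
      refine Finset.sum_congr rfl fun j hj => ?_
      rw [Nat.sub_add_comm (Nat.lt_succ_iff.1 (Finset.mem_range.1 hj))]
      split_ifs
      · rw [hx]
      · rw [hx']
    rw [this]
    simp

/-- Conjugation by an operator, as an additive map. -/
noncomputable def conjBy (C : H →L[ℂ] H) : (H →L[ℂ] H) →+ (H →L[ℂ] H) :=
  (AddMonoidHom.mulRight C).comp (AddMonoidHom.mulLeft (star C))

theorem conjBy_apply (C X : H →L[ℂ] H) : conjBy C X = star C * X * C := rfl

/-- The order interval is a box, so the coordinate `a` can be summed separately; this isolates the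
variable in which the sum telescopes. -/
theorem sum_Icc_single_add {R : Type*} [AddCommMonoid R] {f : Λ →₀ ℤ} {a : Λ} (n : ℕ)
    (ha : f a = 0) [LocallyFiniteOrder (Λ →₀ ℤ)] (F : (Λ →₀ ℤ) → R) :
    ∑ k ∈ Finset.Icc 0 (Finsupp.single a (n : ℤ) + f), F k =
      ∑ k ∈ Finset.Icc 0 f, ∑ j ∈ Finset.range (n + 1), F (Finsupp.single a (j : ℤ) + k) := by
  classical
  rw [← Finset.sum_product']
  symm
  have h0 : ∀ k ∈ Finset.Icc 0 f, k a = 0 := fun k hk => by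
    obtain ⟨h1, h2⟩ := Finset.mem_Icc.1 hk
    exact le_antisymm ((h2 a).trans ha.le) (h1 a)
  refine Finset.sum_nbij' (fun p => Finsupp.single a (p.2 : ℤ) + p.1)
    (fun k => (k.erase a, (k a).toNat)) ?_ ?_ ?_ ?_ ?_
  · rintro ⟨k, j⟩ h
    obtain ⟨hk, hj⟩ := Finset.mem_product.1 h
    obtain ⟨h1, h2⟩ := Finset.mem_Icc.1 hk
    have hj' : j ≤ n := Nat.lt_succ_iff.1 (Finset.mem_range.1 hj)
    refine Finset.mem_Icc.2 ⟨add_nonneg (Finsupp.single_nonneg.2 (by positivity)) h1,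
      add_le_add (Finsupp.single_le_single.2 (by exact_mod_cast hj')) h2⟩
  · intro k hk
    obtain ⟨h1, h2⟩ := Finset.mem_Icc.1 hk
    have h3 : k a ≤ n := by simpa [ha] using h2 a
    refine Finset.mem_product.2 ⟨Finset.mem_Icc.2 ⟨fun c => ?_, fun c => ?_⟩,
      Finset.mem_range.2 (by change (k a).toNat < n + 1; omega)⟩
    · by_cases hc : c = a
      · simp [hc]
      · simpa [Finsupp.erase_ne hc] using h1 c
    · by_cases hc : c = a
      · simp [hc, ha]
      · simpa [Finsupp.erase_ne hc, Ne.symm hc] using h2 c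
  · rintro ⟨k, j⟩ h
    have hk := h0 k (Finset.mem_product.1 h).1
    refine Prod.ext ?_ ?_
    · ext c
      by_cases hc : c = a
      · simp [hc, hk]
      · simp [Finsupp.erase_ne hc]
    · simp [hk]
  · intro k hk
    have h1 : 0 ≤ k a := (Finset.mem_Icc.1 hk).1 a
    change Finsupp.single a ((k a).toNat : ℤ) + k.erase a = k
    rw [Int.toNat_of_nonneg h1, Finsupp.single_add_erase]
  · intro p _
    rfl

variable (hs : ∀ x, star (ρ x) = ρ (-x)) (hc : ∀ α x, Commute (T α) (ρ x))
  (hb : ∀ α β, α ≠ β → ρ (-b α β) * (T α * T β) = ρ (-b β α) * (T β * T α))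
include hs hc hb

/-- Conjugation by `ρ x` is trivial on operators commuting with the phases, so the twist disappears
and conjugations compose as in the untwisted case. -/
theorem conjBy_liftRep_add {p q : Λ →₀ ℤ} (hp : 0 ≤ p) (hq : 0 ≤ q) {X : H →L[ℂ] H}
    (hX : ∀ x, Commute X (ρ x)) :
    conjBy (liftRep b ρ T (p + q)) X = conjBy (liftRep b ρ T p) (conjBy (liftRep b ρ T q) X) := by
  set x := bicharacter b q p
  have h1 := liftRep_mul hc hb hq hp
  have h2 : star (ρ x) * ρ x = 1 := by
    rw [hs, ← AddChar.map_add_eq_mul, neg_add_cancel, AddChar.map_zero_eq_one]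
  have h3 : conjBy (liftRep b ρ T p) (conjBy (liftRep b ρ T q) X) =
      star (liftRep b ρ T q * liftRep b ρ T p) * X * (liftRep b ρ T q * liftRep b ρ T p) := by
    simp only [conjBy_apply, star_mul, mul_assoc]
  rw [h3, h1, star_mul, add_comm q p, conjBy_apply]
  calc _ = star (liftRep b ρ T (p + q)) * ((star (ρ x) * ρ x) * X) * liftRep b ρ T (p + q) := by
        rw [h2, one_mul]
    _ = _ := by
        rw [mul_assoc (star (ρ x)), ← (hX x).eq]
        simp only [mul_assoc]
        rfl

/-- Induction on the number of variables in `l`. For a fixed `k` in the other variables, the sum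
over the exponent of `a` telescopes to `brehmerSum T k.support`. -/
theorem sum_conjBy_brehmerSum (hT : IsQCommuting Q T) [LocallyFiniteOrder (Λ →₀ ℤ)]
    (l : Λ →₀ ℤ) (hl : 0 ≤ l) :
    ∑ k ∈ Finset.Icc 0 l, conjBy (liftRep b ρ T (l - k)) (brehmerSum T k.support) = 1 := by
  classical
  have hSc : ∀ u x, Commute (brehmerSum T u) (ρ x) := fun u x =>
    brehmerSum_commute (fun α => hc α x) (fun α => by rw [hs]; exact hc α _) u
  induction l using Finsupp.induction with
  | zero =>
    simp [liftRep_zero hc hb, conjBy_apply]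
  | single_add a m f ha _ ih =>
    have hfa : f a = 0 := Finsupp.notMem_support_iff.1 ha
    have hf : 0 ≤ f := by
      intro c
      by_cases hc : c = a
      · rw [hc, hfa]
        rfl
      · simpa [Finsupp.single_apply, Ne.symm hc] using hl c
    have hm : 0 ≤ m := by simpa [hfa] using hl a
    lift m to ℕ using hm with n
    rw [sum_Icc_single_add n hfa, ← ih hf]
    refine Finset.sum_congr rfl fun k hk => ?_
    obtain ⟨hk0, hkf⟩ := Finset.mem_Icc.1 hk
    have hka : k a = 0 := le_antisymm ((hkf a).trans hfa.le) (hk0 a)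
    have hka' : a ∉ k.support := Finsupp.notMem_support_iff.2 hka
    set W : ℕ → (H →L[ℂ] H) →+ (H →L[ℂ] H) := fun i =>
      conjBy (liftRep b ρ T (Finsupp.single a (i : ℤ))) with hWdef
    set x := brehmerSum T k.support with hx
    have hW0 : W 0 = .id _ := by
      ext1 X
      simp [hWdef, conjBy_apply, liftRep_zero hc hb]
    have hW1 : ∀ X, W 1 X = star (T a) * X * T a := fun X => by
      simp [hWdef, conjBy_apply, liftRep_single hc hb]
    have hWadd : ∀ X, (∀ y, Commute X (ρ y)) → ∀ i, W (i + 1) X = W 1 (W i X) := fun X hX i => by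
      simp only [hWdef]
      rw [← conjBy_liftRep_add hs hc hb (Finsupp.single_nonneg.2 (by positivity))
        (Finsupp.single_nonneg.2 (by positivity)) hX, ← Finsupp.single_add, add_comm i 1]
      norm_cast
    have hins : brehmerSum T (insert a k.support) = x - W 1 x := by
      rw [hT.brehmerSum_insert hka', hW1]
    have htel := sum_defect_single W hW0 x (hWadd x (hSc _))
      (hWadd _ (hins ▸ hSc (insert a k.support))) n
    conv_rhs => rw [← htel, map_sum]
    refine Finset.sum_congr rfl fun j hj => ?_
    have hjn : j ≤ n := Nat.lt_succ_iff.1 (Finset.mem_range.1 hj)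
    have hdeg : Finsupp.single a (n : ℤ) + f - (Finsupp.single a (j : ℤ) + k) =
        (f - k) + Finsupp.single a ((n - j : ℕ) : ℤ) := by
      rw [Nat.cast_sub hjn, Finsupp.single_sub]
      abel
    -- A positive exponent of `a` inserts `a` into the support, whatever its size; exponent zero
    -- leaves the support alone.
    have hsupp : brehmerSum T (Finsupp.single a (j : ℤ) + k).support =
        if j = 0 then x else x - W 1 x := by
      split_ifs with h0
      · simp [h0, hx]
      · rw [← hins, Finsupp.support_single_add hka' (by exact_mod_cast h0), Finset.cons_eq_insert]
    rw [hdeg, conjBy_liftRep_add hs hc hb (sub_nonneg.2 hkf)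
      (Finsupp.single_nonneg.2 (by positivity)) (hSc _), hsupp]

end Brehmer

/-! ### Dilation of products of words. -/

section WordDilation

variable {Λ : Type v} {H : Type u} [NormedAddCommGroup H] [InnerProductSpace ℂ H]
  [CompleteSpace H] {Q : Λ → Λ → H →L[ℂ] H} {T : Λ → H →L[ℂ] H}

/-- Under Brehmer's condition there are `Q`-commuting unitaries on a larger space that compress to
`T` on all products of an adjoint of a word and a word in different letters. -/
theorem IsQCommuting.exists_word_dilation (hT : IsQCommuting Q T) (hB : BrehmerPositive T) :
    ∃ (K : Type (max u v)) (_ : NormedAddCommGroup K) (_ : InnerProductSpace ℂ K)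
      (_ : CompleteSpace K) (ι : H →ₗᵢ[ℂ] K) (Q' : Λ → Λ → K →L[ℂ] K)
      (U : Λ → unitary (K →L[ℂ] K)),
      IsQCommuting Q' (fun α => (U α : K →L[ℂ] K)) ∧
      (∀ α β, α ≠ β → ∀ h : H, Q' α β (ι h) = ι (Q α β h)) ∧
      ∀ l₁ l₂ : List Λ, l₁.Disjoint l₂ → ι.toContinuousLinearMap.adjoint ∘L
        (star (l₂.map fun α => (U α : K →L[ℂ] K)).prod *
          (l₁.map fun α => (U α : K →L[ℂ] K)).prod) ∘L ι.toContinuousLinearMap =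
        star (l₂.map T).prod * (l₁.map T).prod := by
  classical
  obtain ⟨A, _, ρ, q, hs, hc, hq, hq'⟩ := hT.exists_phases
  -- A bicharacter with `b α β - b β α = q α β` is needed. As `q` cannot in general be halved in
  -- `A`, an arbitrary order on the letters puts all of `q α β` on one of the two pairs.
  let _ : LinearOrder Λ := linearOrderOfSTO (WellOrderingRel (α := Λ))
  let b : Λ → Λ → A := fun α β => if β < α then q α β else 0
  have hbq : ∀ α β, α ≠ β → b α β = q α β + b β α := fun α β h => by
    rcases lt_or_gt_of_ne h with h1 | h1
    · simp [b, h1, h1.not_gt, hq' α β h]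
    · simp [b, h1, h1.not_gt]
  have hb : ∀ α β, α ≠ β → ρ (-b α β) * (T α * T β) = ρ (-b β α) * (T β * T α) := fun α β h => by
    rw [hT.rel α β h, ← hq α β h, ← mul_assoc, ← AddChar.map_add_eq_mul, hbq α β h]
    congr 2
    abel
  have hrep : TwistedRep (bicharacter b) ρ (liftRep b ρ T) (fun k => brehmerSum T k.support) :=
    { star_phase := hs
      comm := liftRep_commute hc
      apply_zero := liftRep_zero hc hb
      apply_mul := fun p q hp hq => liftRep_mul hc hb hp hq
      defect_comm := fun p x =>
        brehmerSum_commute (fun α => hc α x) (fun α => by rw [hs]; exact hc α _) _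
      defect_nonneg := fun p => hB _
      sum_defect := fun l hl => sum_conjBy_brehmerSum hs hc hb hT l hl }
  obtain ⟨K, _, _, _, ι, σ, U, hσs, hUu, hUσ, hUm, hU0, hσι, hdil⟩ := hrep.exists_dilation
  have hσu : ∀ x, σ x ∈ unitary (K →L[ℂ] K) := fun x => Unitary.mem_iff.2 (by
    rw [hσs, ← AddChar.map_add_eq_mul, ← AddChar.map_add_eq_mul, neg_add_cancel, add_neg_cancel,
      AddChar.map_zero_eq_one]
    exact ⟨rfl, rfl⟩)
  have hword : ∀ l : List Λ, (l.map fun α => U (Finsupp.single α 1)).prod =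
      σ (wordPhase b l) * U (wordDegree l) := by
    intro l
    induction l with
    | nil => simp [wordPhase, hU0]
    | cons α l ih =>
      rw [List.map_cons, List.prod_cons, ih, (hUσ _ _).left_comm, hUm, ← mul_assoc,
        ← AddChar.map_add_eq_mul, wordDegree_cons, wordPhase]
  refine ⟨K, inferInstance, inferInstance, inferInstance, ι, fun α β => σ (q α β),
    fun α => ⟨U (Finsupp.single α 1), hUu _⟩, ⟨?_, ?_, ?_, ?_, ?_⟩, ?_, ?_⟩
  · exact fun α β _ => hσu _
  · intro α β h
    rw [hσs, hq' α β h]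
  · exact fun α β γ δ _ _ => (AddChar.commute_apply σ _ _).eq
  · exact fun α β k _ => (hUσ _ _).eq
  · intro α β h
    change U _ * U _ = σ _ * (U _ * U _)
    rw [hUm, hUm, ← mul_assoc, ← AddChar.map_add_eq_mul, bicharacter_single, bicharacter_single,
      hbq α β h, add_comm (Finsupp.single α (1 : ℤ))]
  · intro α β h v
    rw [hσι, hq α β h]
  · intro l₁ l₂ hl
    -- Words on `K` and on `H` differ from their normal forms by the same phase, which is moved to
    -- the right to be carried across `ι`.
    have hK : star (l₂.map fun α => U (Finsupp.single α 1)).prod *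
        (l₁.map fun α => U (Finsupp.single α 1)).prod =
        star (U (wordDegree l₂)) * U (wordDegree l₁) * σ (-wordPhase b l₂ + wordPhase b l₁) := by
      rw [hword, hword, star_mul, hσs, mul_assoc, ← mul_assoc (σ _), ← AddChar.map_add_eq_mul,
        ← (hUσ _ _).eq, mul_assoc]
    have hH : star (l₂.map T).prod * (l₁.map T).prod =
        star (liftRep b ρ T (wordDegree l₂)) * liftRep b ρ T (wordDegree l₁) *
          ρ (-wordPhase b l₂ + wordPhase b l₁) := by
      rw [prod_map_eq_liftRep hc hb, prod_map_eq_liftRep hc hb, star_mul, hs, mul_assoc,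
        ← mul_assoc (ρ _), ← AddChar.map_add_eq_mul, ← (liftRep_commute hc _ _).eq, mul_assoc]
    have hι : ∀ x, σ x ∘L ι.toContinuousLinearMap = ι.toContinuousLinearMap ∘L ρ x := fun x => by
      ext v
      exact hσι x v
    change _ ∘L (star (l₂.map fun α => U (Finsupp.single α 1)).prod *
        (l₁.map fun α => U (Finsupp.single α 1)).prod) ∘L _ = _
    rw [hK, hH, ← hdil _ _ (wordDegree_inf_eq_zero hl), ContinuousLinearMap.mul_def _ (σ _),
      ContinuousLinearMap.comp_assoc, hι]
    rfl

end WordDilation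

/-! ### Regular products of unitaries. -/

section Rearrangement

theorem pow_mul_pow_of_skew {R : Type*} [Monoid R] {x y c : R} (h : x * y = c * (y * x))
    (hx : Commute x c) (hy : Commute y c) (p q : ℕ) :
    x ^ p * y ^ q = c ^ (p * q) * (y ^ q * x ^ p) := by
  have h1 : ∀ q : ℕ, x * y ^ q = c ^ q * (y ^ q * x) := by
    intro q
    induction q with
    | zero => simp
    | succ q ih =>
      rw [pow_succ, ← mul_assoc, ih, mul_assoc, mul_assoc, h, (hy.pow_left q).left_comm,
        ← mul_assoc, ← pow_succ, mul_assoc]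
  induction p with
  | zero => simp
  | succ p ih =>
    rw [pow_succ, mul_assoc, h1, ((hx.pow_left p).pow_right q).left_comm, ← mul_assoc (x ^ p), ih,
      ← mul_assoc, ← mul_assoc, ← pow_add, mul_assoc, mul_assoc]
    congr 2
    ring

variable {Λ : Type v} {H : Type u} [NormedAddCommGroup H] [InnerProductSpace ℂ H]
  [CompleteSpace H] {Q : Λ → Λ → H →L[ℂ] H} {T : Λ → H →L[ℂ] H}

theorem phase_succ (Q : Λ → Λ → H →L[ℂ] H) {k : ℕ} (α : Fin (k + 1) → Λ) (m : Fin (k + 1) → ℤ) :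
    phase Q α m = (List.ofFn fun j : Fin k =>
      star (Q (α 0) (α j.succ)) ^ ((m 0).toNat * (-m j.succ).toNat)).prod *
        phase Q (fun i => α i.succ) (fun i => m i.succ) := by
  simp [phase, List.ofFn_succ]

theorem list_ofFn_prod_commute {R : Type*} [Monoid R] {k : ℕ} {f : Fin k → R} {c : R}
    (h : ∀ i, Commute (f i) c) : Commute (List.ofFn f).prod c :=
  Commute.list_prod_left _ _ fun x hx => by
    obtain ⟨i, rfl⟩ := (List.mem_ofFn' f x).1 hx
    exact h i

theorem phase_commute {c : H →L[ℂ] H} (h : ∀ α β, α ≠ β → Commute (star (Q α β)) c) {k : ℕ}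
    {α : Fin k → Λ} (hα : Function.Injective α) (m : Fin k → ℤ) : Commute (phase Q α m) c :=
  list_ofFn_prod_commute fun i => list_ofFn_prod_commute fun j => by
    split_ifs with hij
    · exact (h _ _ (hα.ne hij.ne)).pow_left _
    · exact Commute.one_left _

theorem IsQCommuting.commute_star (hT : IsQCommuting Q T) {α β : Λ} (h : α ≠ β) (k : Λ) :
    Commute (star (Q α β)) (T k) := by
  rw [← hT.symm β α h.symm]
  exact (hT.comm_right β α k h.symm).symm

theorem IsQCommuting.commute_star_star (hT : IsQCommuting Q T) {α β : Λ} (h : α ≠ β) (k : Λ) :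
    Commute (star (Q α β)) (star (T k)) :=
  (show Commute (Q α β) (T k) from (hT.comm_right α β k h).symm).star_star

/-- `Q`-commuting unitaries are doubly `Q`-commuting. -/
theorem IsQCommuting.rel_star_of_unitary {U : Λ → unitary (H →L[ℂ] H)}
    (hU : IsQCommuting Q (fun α => (U α : H →L[ℂ] H))) {α β : Λ} (h : α ≠ β) :
    (U α : H →L[ℂ] H) * star (U β : H →L[ℂ] H) =
      star (Q α β) * (star (U β : H →L[ℂ] H) * (U α : H →L[ℂ] H)) := by
  have hr := hU.rel _ _ h
  have hq := (Unitary.mem_iff.1 (hU.unitary_mem _ _ h)).1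
  have hu1 := (Unitary.mem_iff.1 (U β).2).1
  have hu2 := (Unitary.mem_iff.1 (U β).2).2
  have hcs := hU.commute_star_star h β
  have h1 : star (U β : H →L[ℂ] H) * (U α : H →L[ℂ] H) =
      star (U β : H →L[ℂ] H) * ((U α : H →L[ℂ] H) * (U β : H →L[ℂ] H)) *
        star (U β : H →L[ℂ] H) := by
    rw [mul_assoc, mul_assoc, hu2, mul_one]
  rw [h1, hr, ← mul_assoc, ← mul_assoc, ← mul_assoc, hcs.eq,
    mul_assoc _ (star (Q _ _)) (Q _ _), hq, mul_one, ← mul_assoc, hu1, one_mul]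

/-- For unitaries, the ordered product with integer exponents splits as in the definition of the
regular product. -/
theorem regularProduct_unitary {U : Λ → unitary (H →L[ℂ] H)}
    (hU : IsQCommuting Q (fun α => (U α : H →L[ℂ] H))) {k : ℕ} (α : Fin k → Λ)
    (hα : Function.Injective α) (m : Fin k → ℤ) :
    regularProduct Q (fun α => (U α : H →L[ℂ] H)) α m =
      ((List.ofFn fun i : Fin k => U (α i) ^ m i).prod : unitary (H →L[ℂ] H)).1 := by
  induction k with
  | zero => simp [regularProduct, phase]
  | succ k ih =>
    have hα' : Function.Injective fun i : Fin k => α i.succ :=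
      hα.comp (Fin.succ_injective k)
    have hne : ∀ j : Fin k, α 0 ≠ α j.succ := fun j => hα.ne (Fin.succ_ne_zero j).symm
    have ih' := ih _ hα' (fun i => m i.succ)
    rw [List.ofFn_succ, List.prod_cons, Submonoid.coe_mul, ← ih']
    simp only [regularProduct, phase_succ, List.ofFn_succ, List.prod_cons]
    set row := (List.ofFn fun j : Fin k =>
      star (Q (α 0) (α j.succ)) ^ ((m 0).toNat * (-m j.succ).toNat)).prod with hrow
    set ph := phase Q (fun i => α i.succ) (fun i => m i.succ)
    set u : H →L[ℂ] H := (U (α 0)).1 with hu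
    -- One of the two exponents is always zero, and the inverse of a unitary is its adjoint.
    have hz : ((U (α 0) ^ m 0 : unitary (H →L[ℂ] H)) : H →L[ℂ] H) =
        star (u ^ (-m 0).toNat) * u ^ (m 0).toNat := by
      rcases le_total 0 (m 0) with h | h
      · rw [Int.toNat_eq_zero.2 (neg_nonpos.2 h), pow_zero, star_one, one_mul]
        have : m 0 = ((m 0).toNat : ℤ) := by omega
        conv_lhs => rw [this, zpow_natCast]
        rfl
      · rw [Int.toNat_eq_zero.2 h, pow_zero, mul_one]
        have : m 0 = -(((-m 0).toNat : ℕ) : ℤ) := by omega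
        conv_lhs => rw [this, zpow_neg, zpow_natCast]
        rfl
    have hskew' : ∀ (j : Fin k) (p q : ℕ), u ^ p * star ((U (α j.succ) : H →L[ℂ] H) ^ q) =
        star (Q (α 0) (α j.succ)) ^ (p * q) *
          (star ((U (α j.succ) : H →L[ℂ] H) ^ q) * u ^ p) := fun j p q => by
      rw [star_pow]
      exact pow_mul_pow_of_skew (hU.rel_star_of_unitary (hne j)) (hU.commute_star (hne _) _).symm
        (hU.commute_star_star (hne _) _).symm p q
    -- Moving the positive power of the first letter past the adjoints produces the first row of the
    -- phase. The reindexing `f` is arbitrary so that the induction can pass to tails while `k`, `α`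
    -- and `m` stay fixed.
    have hmove : ∀ (n : ℕ) (f : Fin n → Fin k), u ^ (m 0).toNat *
        (List.ofFn fun i : Fin n =>
          star ((U (α (f i).succ) : H →L[ℂ] H) ^ (-m (f i).succ).toNat)).prod =
        (List.ofFn fun i : Fin n =>
          star (Q (α 0) (α (f i).succ)) ^ ((m 0).toNat * (-m (f i).succ).toNat)).prod *
        (List.ofFn fun i : Fin n =>
          star ((U (α (f i).succ) : H →L[ℂ] H) ^ (-m (f i).succ).toNat)).prod *
        u ^ (m 0).toNat := by
      intro n
      induction n with
      | zero => intro f; simp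
      | succ n ihn =>
        intro f
        have hcomm : ∀ i, Commute
            (star ((U (α (f 0).succ) : H →L[ℂ] H) ^ (-m (f 0).succ).toNat))
            (star (Q (α 0) (α (f i).succ)) ^ ((m 0).toNat * (-m (f i).succ).toNat)) := fun i => by
          rw [star_pow]
          exact ((hU.commute_star_star (hne (f i)) _).symm.pow_left _).pow_right _
        have hc2 := (list_ofFn_prod_commute fun i : Fin n => (hcomm i.succ).symm).symm
        rw [List.ofFn_succ, List.prod_cons, ← mul_assoc, hskew', mul_assoc, mul_assoc,
          ihn (fun i => f i.succ), List.ofFn_succ, List.prod_cons]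
        simp only [mul_assoc]
        rw [hc2.left_comm]
    have hmove' := hmove k id
    simp only [id] at hmove'
    have hph : ∀ x : H →L[ℂ] H, (∀ α β, α ≠ β → Commute (star (Q α β)) x) → Commute ph x :=
      fun x hx => phase_commute hx hα' _
    have hph1 : Commute ph (u ^ (m 0).toNat) :=
      hph _ fun _ _ h => (hU.commute_star h _).pow_right _
    have hph2 : Commute ph (star (u ^ (-m 0).toNat)) := hph _ fun _ _ h => by
      rw [star_pow]
      exact (hU.commute_star_star h _).pow_right _
    have hrow2 : Commute row (star (u ^ (-m 0).toNat)) := list_ofFn_prod_commute fun j => by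
      rw [star_pow]
      exact ((hU.commute_star_star (hne j) _).pow_right _).pow_left _
    rw [hz]
    simp only [mul_assoc]
    rw [hph1.symm.left_comm, hph2.symm.left_comm, ← mul_assoc (u ^ (m 0).toNat), hmove',
      ← hrow]
    simp only [mul_assoc]
    rw [← hrow2.left_comm, ← (show Commute row ph from (hph row fun γ δ h =>
      (list_ofFn_prod_commute fun j => by
        have := hU.comm (α j.succ) (α 0) δ γ (hne j).symm h.symm
        rw [hU.symm _ _ (hne j).symm, hU.symm _ _ h.symm] at this
        exact (show Commute _ _ from this).pow_left _).symm).symm).left_comm]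

end Rearrangement

/-! ### From Brehmer positivity to the regular dilation. -/

section Regular

variable {Λ : Type v} {H : Type u} [NormedAddCommGroup H] [InnerProductSpace ℂ H]
  {K : Type*} [NormedAddCommGroup K] [InnerProductSpace ℂ K]

/-- The word `α₀^{n₀} α₁^{n₁} ⋯`. -/
def expWord {k : ℕ} (α : Fin k → Λ) (n : Fin k → ℕ) : List Λ :=
  (List.ofFn fun i => List.replicate (n i) (α i)).flatten

theorem prod_map_expWord {R : Type*} [Monoid R] (f : Λ → R) {k : ℕ} (α : Fin k → Λ)
    (n : Fin k → ℕ) :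
    ((expWord α n).map f).prod = (List.ofFn fun i => f (α i) ^ n i).prod := by
  rw [expWord, List.map_flatten, List.prod_flatten, List.map_map, List.map_ofFn]
  congr 2
  ext i
  simp

theorem mem_expWord {k : ℕ} {α : Fin k → Λ} {n : Fin k → ℕ} {x : Λ} :
    x ∈ expWord α n ↔ ∃ i, n i ≠ 0 ∧ x = α i := by
  simp [expWord, List.mem_flatten, List.mem_ofFn, List.mem_replicate]

theorem star_prod_map {R : Type*} [Monoid R] [StarMul R] (f : Λ → R) (l : List Λ) :
    star (l.map f).prod = (l.reverse.map fun x => star (f x)).prod := by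
  induction l with
  | nil => simp
  | cons x l ih => simp [ih]

theorem prod_intertwine {X : H →L[ℂ] K} {k : ℕ} {f : Fin k → K →L[ℂ] K} {g : Fin k → H →L[ℂ] H}
    (h : ∀ i, f i ∘L X = X ∘L g i) : (List.ofFn f).prod ∘L X = X ∘L (List.ofFn g).prod := by
  induction k with
  | zero => ext; simp
  | succ k ih =>
    rw [List.ofFn_succ, List.ofFn_succ, List.prod_cons, List.prod_cons,
      ContinuousLinearMap.mul_def, ContinuousLinearMap.comp_assoc, ih fun i => h i.succ,
      ← ContinuousLinearMap.comp_assoc, h, ContinuousLinearMap.comp_assoc]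
    rfl

theorem pow_intertwine {X : H →L[ℂ] K} {f : K →L[ℂ] K} {g : H →L[ℂ] H}
    (h : f ∘L X = X ∘L g) (n : ℕ) : (f ^ n) ∘L X = X ∘L g ^ n := by
  have := prod_intertwine (k := n) (f := fun _ => f) (g := fun _ => g) fun _ => h
  simpa using this

variable [CompleteSpace H] [CompleteSpace K] {Q : Λ → Λ → H →L[ℂ] H} {T : Λ → H →L[ℂ] H}
  {Q' : Λ → Λ → K →L[ℂ] K}

theorem phase_intertwine {X : H →L[ℂ] K}
    (h : ∀ α β, α ≠ β → star (Q' α β) ∘L X = X ∘L star (Q α β)) {k : ℕ} {α : Fin k → Λ}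
    (hα : Function.Injective α) (m : Fin k → ℤ) :
    phase Q' α m ∘L X = X ∘L phase Q α m :=
  prod_intertwine fun i => prod_intertwine fun j => by
    split_ifs with hij
    · exact pow_intertwine (h _ _ (hα.ne hij.ne)) _
    · rfl

/-- The phase goes to the right, where it can be carried across the embedding. The word under the
adjoint is reversed because the adjoint reverses products. -/
theorem IsQCommuting.regularProduct_eq (hT : IsQCommuting Q T) {k : ℕ} {α : Fin k → Λ}
    (hα : Function.Injective α) (m : Fin k → ℤ) :
    regularProduct Q T α m =
      star ((expWord α fun i => (-m i).toNat).reverse.map T).prod *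
        ((expWord α fun i => (m i).toNat).map T).prod * phase Q α m := by
  rw [star_prod_map, List.reverse_reverse, prod_map_expWord, prod_map_expWord, regularProduct]
  simp only [star_pow]
  rw [mul_assoc]
  refine (phase_commute (fun β γ h => ?_) hα m).eq
  refine Commute.mul_right ?_ ?_
  · exact (list_ofFn_prod_commute fun i =>
      ((hT.commute_star_star h _).pow_right _).symm).symm
  · exact (list_ofFn_prod_commute fun i => ((hT.commute_star h _).pow_right _).symm).symm

theorem IsQCommuting.hasRegularQUnitaryDilation (hT : IsQCommuting Q T)
    (hB : BrehmerPositive T) : HasRegularQUnitaryDilation Q T := by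
  obtain ⟨K, _, _, _, ι, Q', U, hU, hQ, hw⟩ := hT.exists_word_dilation hB
  refine ⟨K, inferInstance, inferInstance, inferInstance, ι, Q', U, hU, hQ,
    fun k α hα m => ?_⟩
  rw [← regularProduct_unitary hU α hα m]
  let word : List Λ := expWord α fun i => (m i).toNat
  let word' : List Λ := (expWord α fun i => (-m i).toNat).reverse
  have hdisj : word.Disjoint word' := fun x hx hx' => by
    obtain ⟨i, hi, rfl⟩ := mem_expWord.1 hx
    obtain ⟨j, hj, hij⟩ := mem_expWord.1 (List.mem_reverse.1 hx')
    have := hα hij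
    subst this
    omega
  have hι : ∀ β γ, β ≠ γ →
      star (Q' β γ) ∘L ι.toContinuousLinearMap = ι.toContinuousLinearMap ∘L star (Q β γ) :=
    fun β γ h => by
      rw [← hU.symm γ β h.symm, ← hT.symm γ β h.symm]
      ext v
      exact hQ γ β h.symm v
  rw [hT.regularProduct_eq hα, hU.regularProduct_eq hα, ← hw word word' hdisj,
    ContinuousLinearMap.mul_def _ (phase Q' α m), ContinuousLinearMap.comp_assoc,
    phase_intertwine hι hα m]
  rfl

end Regular

/-! ### From a regular dilation to Brehmer positivity. -/

section Converse

variable {Λ : Type v} {H : Type u} [NormedAddCommGroup H] [InnerProductSpace ℂ H]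
  [CompleteSpace H] {Q : Λ → Λ → H →L[ℂ] H} {T : Λ → H →L[ℂ] H}
  {K : Type*} [NormedAddCommGroup K] [InnerProductSpace ℂ K] [CompleteSpace K]
  {Q' : Λ → Λ → K →L[ℂ] K} {U : Λ → unitary (K →L[ℂ] K)}

theorem list_ofFn_append {R : Type*} {a b : ℕ} (f : Fin (a + b) → R) :
    List.ofFn f = (List.ofFn fun i : Fin a => f (Fin.castAdd b i)) ++
      List.ofFn fun j : Fin b => f (Fin.natAdd a j) :=
  List.ofFn_add

theorem list_ofFn_comp_get {R : Type*} (f : Λ → R) (l : List Λ) :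
    (List.ofFn fun i => f (l.get i)) = l.map f := by
  conv_rhs => rw [← List.ofFn_get l, List.map_ofFn]
  rfl

theorem word_compression_of_regular {ι : H →L[ℂ] K}
    (h : ∀ (k : ℕ) (α : Fin k → Λ), Function.Injective α → ∀ m : Fin k → ℤ,
      regularProduct Q T α m = ι.adjoint ∘L
        ((List.ofFn fun i : Fin k => U (α i) ^ m i).prod : unitary (K →L[ℂ] K)).1 ∘L ι)
    (w w' : List Λ) (hw : (w' ++ w).Nodup) :
    ι.adjoint ∘L (star (w'.map fun α => (U α : K →L[ℂ] K)).prod *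
      (w.map fun α => (U α : K →L[ℂ] K)).prod) ∘L ι =
        star (w'.map T).prod * (w.map T).prod := by
  obtain ⟨hn', hn, hd⟩ := List.nodup_append'.1 hw
  -- All exponents `-1` precede all exponents `1`, so no pair `i < j` contributes to the phase.
  let α : Fin (w'.reverse.length + w.length) → Λ := Fin.append w'.reverse.get w.get
  let m : Fin (w'.reverse.length + w.length) → ℤ := Fin.append (fun _ => -1) (fun _ => 1)
  have hα : Function.Injective α := by
    refine Fin.append_injective_iff.2 ⟨List.nodup_iff_injective_get.1 (List.nodup_reverse.2 hn'),
      List.nodup_iff_injective_get.1 hn, fun i j hij => ?_⟩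
    exact hd (List.mem_reverse.1 (List.get_mem w'.reverse i)) (hij ▸ List.get_mem w j)
  have hphase : phase Q α m = 1 := by
    refine List.prod_eq_one fun x hx => ?_
    obtain ⟨i, rfl⟩ := (List.mem_ofFn' _ x).1 hx
    refine List.prod_eq_one fun y hy => ?_
    obtain ⟨j, rfl⟩ := (List.mem_ofFn' _ y).1 hy
    beta_reduce
    split_ifs with hij
    · induction i using Fin.addCases with
      | left i => simp [m]
      | right i =>
        induction j using Fin.addCases with
        | left j =>
          have : w'.reverse.length + (i : ℕ) < j := hij
          have := j.2
          omega
        | right j => simp [m]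
    · rfl
  have key := h _ α hα m
  have hUU : (((List.ofFn fun i => U (α i) ^ m i).prod : unitary (K →L[ℂ] K)) : K →L[ℂ] K) =
      star (w'.map fun α => (U α : K →L[ℂ] K)).prod * (w.map fun α => (U α : K →L[ℂ] K)).prod := by
    rw [list_ofFn_append, List.prod_append, Submonoid.coe_mul, star_prod_map]
    simp only [α, m, Fin.append_left, Fin.append_right, zpow_one, zpow_neg]
    rw [list_ofFn_comp_get (fun x => (U x)⁻¹), list_ofFn_comp_get U]
    congr 1
    · rw [Submonoid.coe_list_prod, List.map_map]
      rfl
    · rw [Submonoid.coe_list_prod, List.map_map]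
      rfl
  have hTT : regularProduct Q T α m = star (w'.map T).prod * (w.map T).prod := by
    rw [regularProduct, hphase, one_mul, star_prod_map, list_ofFn_append, list_ofFn_append]
    simp only [α, m, Fin.append_left, Fin.append_right]
    simp only [List.prod_append]
    simp only [neg_neg, Int.toNat_one, pow_one]
    rw [list_ofFn_comp_get (fun x => star (T x)), list_ofFn_comp_get T]
    simp
  rw [← hTT, key, hUU]

/-- Moving a letter past a word produces corresponding phases on both spaces. -/
theorem exists_phase_pair (hU : IsQCommuting Q' (fun α => (U α : K →L[ℂ] K)))
    (hT : IsQCommuting Q T) (β : Λ) (w : List Λ) (hβ : β ∉ w) :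
    ∃ (c' : K →L[ℂ] K) (c : H →L[ℂ] H),
      (∀ X : H →L[ℂ] K, (∀ α β, α ≠ β → Q' α β ∘L X = X ∘L Q α β) →
        star c' ∘L X = X ∘L star c) ∧
      (w.map fun α => (U α : K →L[ℂ] K)).prod * star (U β : K →L[ℂ] K) =
        star (U β : K →L[ℂ] K) * (w.map fun α => (U α : K →L[ℂ] K)).prod * star c' ∧
      (w.map T).prod * star c * T β = T β * (w.map T).prod := by
  induction w with
  | nil => exact ⟨1, 1, fun X _ => by rw [star_one, star_one]; rfl, by simp, by simp⟩
  | cons x w ih =>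
    obtain ⟨c', c, h4, h5, h6⟩ := ih fun h => hβ (List.mem_cons_of_mem _ h)
    have hx : x ≠ β := fun h => hβ (h ▸ List.mem_cons_self)
    have hq := (Unitary.mem_iff.1 (hT.unitary_mem _ _ hx)).1
    refine ⟨c' * Q' x β, c * Q x β, fun X hX => ?_, ?_, ?_⟩
    · rw [star_mul, star_mul, ContinuousLinearMap.mul_def, ContinuousLinearMap.comp_assoc,
        h4 X hX, ← hU.symm β x hx.symm, ← ContinuousLinearMap.comp_assoc, hX _ _ hx.symm,
        hT.symm β x hx.symm]
      rfl
    · have hc : Commute (star (Q' x β)) (w.map fun α => (U α : K →L[ℂ] K)).prod :=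
        (commute_prod_map (fun k => (hU.commute_star hx k).symm) w).symm
      have hc1 := hU.commute_star_star hx β
      have hc2 := hU.commute_star hx x
      rw [List.map_cons, List.prod_cons, mul_assoc, h5, star_mul, mul_assoc, ← mul_assoc,
        hU.rel_star_of_unitary hx, mul_assoc, mul_assoc, hc1.left_comm, hc2.left_comm,
        hc.left_comm]
      simp only [mul_assoc]
    · have hc : Commute (star (Q x β)) (w.map T).prod :=
        (commute_prod_map (fun k => (hT.commute_star hx k).symm) w).symm
      rw [List.map_cons, List.prod_cons, star_mul, mul_assoc, mul_assoc, mul_assoc,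
        ← hc.left_comm, ← mul_assoc _ (star c), h6, ← (hT.commute_star hx x).left_comm,
        ← mul_assoc (T x), hT.rel _ _ hx, ← mul_assoc, ← mul_assoc, hq, one_mul, mul_assoc]

/-- Expands the passage from `X_u` to `X_{u ∪ {β}}`, with `W = U_β` and `A = T_β`. -/
theorem compression_sub (X : H →L[ℂ] K) (V W : K →L[ℂ] K) (A : H →L[ℂ] H) :
    (X - star W ∘L X ∘L A).adjoint ∘L V ∘L (X - star W ∘L X ∘L A) =
      X.adjoint ∘L V ∘L X - (X.adjoint ∘L (V * star W) ∘L X) * A -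
        star A * (X.adjoint ∘L (W * V) ∘L X) +
        star A * (X.adjoint ∘L (W * V * star W) ∘L X) * A := by
  simp only [map_sub, ContinuousLinearMap.adjoint_comp, ContinuousLinearMap.sub_comp,
    ContinuousLinearMap.comp_sub, ContinuousLinearMap.mul_def, ContinuousLinearMap.star_eq_adjoint,
    ContinuousLinearMap.adjoint_adjoint, ContinuousLinearMap.comp_assoc]
  abel

theorem brehmerPositive_of_regular (hT : IsQCommuting Q T)
    (h : HasRegularQUnitaryDilation Q T) : BrehmerPositive T := by
  classical
  obtain ⟨K, _, _, _, ι, Q', U, hU, hQ, hreg⟩ := h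
  set u : Λ → K →L[ℂ] K := fun α => (U α : K →L[ℂ] K)
  -- The words `w` and `w'` strengthen the induction: the step for `β` uses the hypothesis with `β`
  -- prepended to either word. Positivity only needs both words empty.
  have hmain : ∀ s : Finset Λ, ∃ X : H →L[ℂ] K,
      (∀ α β, α ≠ β → Q' α β ∘L X = X ∘L Q α β) ∧
      ∀ w w' : List Λ, (w' ++ w).Nodup → (∀ x ∈ w' ++ w, x ∉ s) →
        X.adjoint ∘L (star (w'.map u).prod * (w.map u).prod) ∘L X =
          star (w'.map T).prod * brehmerSum T s * (w.map T).prod := by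
    intro s
    induction s using Finset.induction with
    | empty =>
      refine ⟨ι.toContinuousLinearMap, fun α β h => ContinuousLinearMap.ext (hQ α β h),
        fun w w' hw _ => ?_⟩
      rw [brehmerSum_empty, mul_one]
      exact word_compression_of_regular hreg w w' hw
    | insert β s hβ ih =>
      obtain ⟨X, hX, hw⟩ := ih
      refine ⟨X - star (u β) ∘L X ∘L T β, fun α γ h => ?_, fun w w' hn hs => ?_⟩
      · have h1 : Commute (Q' α γ) (star (u β)) := by
          rw [hU.symm _ _ h]
          exact hU.commute_star_star h.symm β
        have h2 : Commute (Q α γ) (T β) := (hT.comm_right _ _ _ h).symm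
        rw [ContinuousLinearMap.comp_sub, ContinuousLinearMap.sub_comp, hX _ _ h]
        congr 1
        rw [← ContinuousLinearMap.comp_assoc, ← ContinuousLinearMap.mul_def, h1.eq,
          ContinuousLinearMap.mul_def, ContinuousLinearMap.comp_assoc,
          ← ContinuousLinearMap.comp_assoc _ X, hX _ _ h, ContinuousLinearMap.comp_assoc,
          ← ContinuousLinearMap.mul_def, h2.eq]
        rfl
      · have hβw : β ∉ w := fun hm =>
          hs β (List.mem_append_right _ hm) (Finset.mem_insert_self _ _)
        have hβw' : β ∉ w' := fun hm =>
          hs β (List.mem_append_left _ hm) (Finset.mem_insert_self _ _)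
        have hs' : ∀ x ∈ w' ++ w, x ∉ s := fun x hx hm => hs x hx (Finset.mem_insert_of_mem hm)
        obtain ⟨c₁', c₁, hi₁, hu₁, ht₁⟩ := exists_phase_pair hU hT β w hβw
        obtain ⟨c₂', c₂, hi₂, hu₂, ht₂⟩ := exists_phase_pair hU hT β w' hβw'
        have hUβ := (Unitary.mem_iff.1 (U β).2).2
        have hnβ : (β :: (w' ++ w)).Nodup := List.nodup_cons.2
          ⟨fun hm => (List.mem_append.1 hm).elim hβw' hβw, hn⟩
        have hsβ : ∀ x ∈ β :: (w' ++ w), x ∉ s := fun x hx => by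
          rcases List.mem_cons.1 hx with rfl | hx
          · exact hβ
          · exact hs' x hx
        have e0 := hw w w' hn hs'
        have e1 := hw w (β :: w') hnβ hsβ
        have e2 := hw (β :: w) w' (List.perm_middle.nodup_iff.2 hnβ)
          (fun x hx => hsβ x (List.perm_middle.mem_iff.1 hx))
        simp only [List.map_cons, List.prod_cons] at e1 e2
        change u β * star (u β) = 1 at hUβ
        change (w.map u).prod * star (u β) = star (u β) * (w.map u).prod * star c₁' at hu₁
        change (w'.map u).prod * star (u β) = star (u β) * (w'.map u).prod * star c₂' at hu₂
        generalize (w.map u).prod = P at *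
        generalize (w'.map u).prod = P' at *
        generalize (w.map T).prod = R at *
        generalize (w'.map T).prod = R' at *
        -- Phases on `K` at either end of a compression come out as the matching phases on `H`,
        -- where they cancel against those from moving `T β` past the words.
        have hr : ∀ V, X.adjoint ∘L (V * star c₁') ∘L X = (X.adjoint ∘L V ∘L X) * star c₁ :=
          fun V => by
            rw [ContinuousLinearMap.mul_def V, ContinuousLinearMap.comp_assoc, hi₁ X hX]
            rfl
        have hl : ∀ V, X.adjoint ∘L (c₂' * V) ∘L X = c₂ * (X.adjoint ∘L V ∘L X) := fun V => by
          have := congrArg ContinuousLinearMap.adjoint (hi₂ X hX)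
          rw [ContinuousLinearMap.adjoint_comp, ContinuousLinearMap.adjoint_comp,
            ← ContinuousLinearMap.star_eq_adjoint, ← ContinuousLinearMap.star_eq_adjoint,
            star_star, star_star] at this
          rw [ContinuousLinearMap.mul_def c₂', ContinuousLinearMap.comp_assoc,
            ← ContinuousLinearMap.comp_assoc, this]
          rfl
        have hu₂' : u β * star P' = c₂' * (star P' * u β) := by
          have := congrArg star hu₂
          rwa [star_mul, star_mul, star_mul, star_star, star_star] at this
        have ht₂' : star (T β) * c₂ * star R' = star R' * star (T β) := by
          have := congrArg star ht₂
          rwa [star_mul, star_mul, star_mul, star_star, ← mul_assoc] at this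
        have f1 : star P' * P * star (u β) = star (u β * P') * P * star c₁' := by
          rw [mul_assoc, hu₁, star_mul]
          simp only [mul_assoc]
        have f2 : u β * (star P' * P) = c₂' * (star P' * (u β * P)) := by
          rw [← mul_assoc, hu₂']
          simp only [mul_assoc]
        have f3 : u β * (star P' * P) * star (u β) = c₂' * (star P' * P * star c₁') := by
          rw [f2, mul_assoc, mul_assoc, mul_assoc, hu₁, ← mul_assoc (u β), ← mul_assoc (u β), hUβ,
            one_mul, mul_assoc]
        rw [compression_sub, f3, f2, f1, hr, hl, hl, hr, e0, e1, e2, hT.brehmerSum_insert hβ]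
        have g1 : star (T β * R') * brehmerSum T s * R * star c₁ * T β =
            star R' * (star (T β) * brehmerSum T s * T β) * R := by
          rw [mul_assoc _ R, mul_assoc _ (R * star c₁), ht₁, star_mul]
          simp only [mul_assoc]
        have g2 : star (T β) * (c₂ * (star R' * brehmerSum T s * (T β * R))) =
            star R' * (star (T β) * brehmerSum T s * T β) * R := by
          rw [mul_assoc (star R'), ← mul_assoc c₂, ← mul_assoc, ← mul_assoc (star (T β)), ht₂']
          simp only [mul_assoc]
        have g3 : star (T β) * (c₂ * (star R' * brehmerSum T s * R * star c₁)) * T β =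
            star R' * (star (T β) * brehmerSum T s * T β) * R := by
          have : star (T β) * (c₂ * (star R' * brehmerSum T s * R * star c₁)) * T β =
              (star (T β) * c₂ * star R') * brehmerSum T s * (R * star c₁ * T β) := by
            simp only [mul_assoc]
          rw [this, ht₂', ht₁]
          simp only [mul_assoc]
        -- All three correction terms equal `R'* T_β* S(s) T_β R` and carry the signs `-`, `-`, `+`,
        -- so it is subtracted exactly once.
        rw [g1, g2, g3, mul_sub, sub_mul]
        abel
  intro s
  obtain ⟨X, -, hX⟩ := hmain s
  have := hX [] [] (by simp) (by simp)
  simp only [List.map_nil, List.prod_nil, star_one, mul_one, one_mul] at this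
  rw [← this]
  exact ContinuousLinearMap.isPositive_adjoint_comp_self X

end Converse

/-! ### Brehmer positivity in the three special cases. -/

section Cases

variable {Λ : Type v} {H : Type u} [NormedAddCommGroup H] [InnerProductSpace ℂ H]
  [CompleteSpace H] {Q : Λ → Λ → H →L[ℂ] H} {T : Λ → H →L[ℂ] H}

/-- The recursion sends `1` to `1 - T_α* T_α = 0` and keeps `0`. -/
theorem IsQCommuting.brehmerPositive_of_isometry (hT : IsQCommuting Q T)
    (hi : ∀ α, Isometry (T α)) : BrehmerPositive T := by
  classical
  have h1 : ∀ α, star (T α) * T α = 1 := fun α =>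
    (ContinuousLinearMap.isometry_iff_adjoint_comp_self _).1 (hi α)
  have key : ∀ s : Finset Λ, brehmerSum T s = 1 ∨ brehmerSum T s = 0 := fun s => by
    induction s using Finset.induction with
    | empty => exact Or.inl brehmerSum_empty
    | insert α s hα ih =>
      rw [hT.brehmerSum_insert hα]
      rcases ih with h | h
      · rw [h, mul_one, h1, sub_self]
        exact Or.inr rfl
      · rw [h, mul_zero, zero_mul, sub_self]
        exact Or.inr rfl
  intro s
  rcases key s with h | h
  · rw [h]; exact ContinuousLinearMap.isPositive_one
  · rw [h]; exact ContinuousLinearMap.isPositive_zero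

theorem one_sub_star_mul_self_nonneg {A : H →L[ℂ] H} (hA : ‖A‖ ≤ 1) : 0 ≤ 1 - star A * A := by
  have h1 := CStarAlgebra.star_mul_le_algebraMap_norm_sq (a := A)
  have h2 : algebraMap ℝ (H →L[ℂ] H) (‖A‖ ^ 2) ≤ 1 := by
    rw [← map_one (algebraMap ℝ (H →L[ℂ] H))]
    exact algebraMap_mono _ (pow_le_one₀ (norm_nonneg _) hA)
  exact sub_nonneg.2 (h1.trans h2)

/-- The phases cancel in `T_α* T_α`, so it commutes with the other `T β`. Each step of the recursion
then multiplies `S(u)` by the commuting positive operator `1 - T_α* T_α`. -/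
theorem IsDoublyQCommuting.brehmerPositive (hT : IsDoublyQCommuting Q T)
    (hc : ∀ α, ‖T α‖ ≤ 1) : BrehmerPositive T := by
  classical
  have hTT : ∀ α β, β ≠ α → Commute (T β) (star (T α) * T α) := fun α β h => by
    have h1 := hT.toIsQCommuting.commute_star_star h α
    have h2 := (Unitary.mem_iff.1 (hT.unitary_mem _ _ h)).1
    rw [Commute, SemiconjBy, ← mul_assoc, hT.rel_star _ _ h, mul_assoc, mul_assoc, hT.rel _ _ h,
      h1.left_comm, ← mul_assoc (star (Q β α)), h2, one_mul, mul_assoc]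
  have key : ∀ s : Finset Λ, 0 ≤ brehmerSum T s ∧ ∀ β, β ∉ s → Commute (T β) (brehmerSum T s) :=
    fun s => by
      induction s using Finset.induction with
      | empty =>
        rw [brehmerSum_empty]
        exact ⟨zero_le_one, fun β _ => Commute.one_right _⟩
      | insert α s hα ih =>
        obtain ⟨h0, hcomm⟩ := ih
        have e : brehmerSum T (insert α s) = (1 - star (T α) * T α) * brehmerSum T s := by
          rw [hT.toIsQCommuting.brehmerSum_insert hα, sub_mul, one_mul, mul_assoc, mul_assoc,
            (hcomm α hα).eq]
        have h1 : Commute (T α) (brehmerSum T s) := hcomm α hα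
        have h2 : Commute (star (T α)) (brehmerSum T s) := by
          have := h1.star_star
          rwa [(IsSelfAdjoint.of_nonneg h0).star_eq] at this
        rw [e]
        refine ⟨Commute.mul_nonneg (one_sub_star_mul_self_nonneg (hc α)) h0
          ((Commute.one_left _).sub_left (h2.mul_left h1)), fun β hβ => ?_⟩
        rw [Finset.mem_insert, not_or] at hβ
        exact ((Commute.one_right _).sub_right (hTT α β hβ.1)).mul_right (hcomm β hβ.2)
  exact fun s => (ContinuousLinearMap.nonneg_iff_isPositive _).1 (key s).1

/-- The lower bound `1 - ∑_{α ∈ u} ‖T α‖² ≤ S(u)` is proved together with `S(u) ≤ 1`, which bounds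
the subtracted term `T_α* S(u) T_α` by `‖T α‖²`. -/
theorem IsQCommuting.brehmerPositive_of_tsum_le_one (hT : IsQCommuting Q T)
    (hs : Summable fun α => ‖T α‖ ^ 2) (h1 : ∑' α, ‖T α‖ ^ 2 ≤ 1) : BrehmerPositive T := by
  classical
  have hsum : ∀ s : Finset Λ, ∑ α ∈ s, ‖T α‖ ^ 2 ≤ 1 := fun s =>
    (hs.sum_le_tsum s fun _ _ => sq_nonneg _).trans h1
  have hpos : ∀ s : Finset Λ,
      0 ≤ algebraMap ℝ (H →L[ℂ] H) (1 - ∑ α ∈ s, ‖T α‖ ^ 2) := fun s => by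
    rw [← map_zero (algebraMap ℝ (H →L[ℂ] H))]
    exact algebraMap_mono _ (sub_nonneg.2 (hsum s))
  have key : ∀ s : Finset Λ, algebraMap ℝ (H →L[ℂ] H) (1 - ∑ α ∈ s, ‖T α‖ ^ 2) ≤ brehmerSum T s ∧
      brehmerSum T s ≤ 1 := fun s => by
    induction s using Finset.induction with
    | empty => simp
    | insert α s hα ih =>
      obtain ⟨hl, hu⟩ := ih
      have h2 := star_left_conjugate_le_conjugate hu (T α)
      have h3 := star_left_conjugate_nonneg ((hpos s).trans hl) (T α)
      rw [mul_one] at h2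
      rw [hT.brehmerSum_insert hα, Finset.sum_insert hα, add_comm, ← sub_sub]
      refine ⟨?_, (sub_le_self _ h3).trans hu⟩
      rw [map_sub]
      exact sub_le_sub hl (h2.trans CStarAlgebra.star_mul_le_algebraMap_norm_sq)
  exact fun s => (ContinuousLinearMap.nonneg_iff_isPositive _).1 ((hpos s).trans (key s).1)

end Cases

end QDilation

theorem mainTheorem9 {Λ : Type v} {H : Type u} [NormedAddCommGroup H] [InnerProductSpace ℂ H]
    [CompleteSpace H] (Q : Λ → Λ → H →L[ℂ] H) (T : Λ → H →L[ℂ] H)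
    (hT : QDilation.IsQCommuting Q T) (hc : ∀ α, ‖T α‖ ≤ 1) :
    (QDilation.HasRegularQUnitaryDilation Q T ↔ QDilation.BrehmerPositive T) ∧
    ((∀ α, Isometry (T α)) → QDilation.HasRegularQUnitaryDilation Q T) ∧
    (QDilation.IsDoublyQCommuting Q T → QDilation.HasRegularQUnitaryDilation Q T) ∧
    (Countable Λ → Summable (fun α => ‖T α‖ ^ 2) → ∑' α, ‖T α‖ ^ 2 ≤ 1 →
      QDilation.HasRegularQUnitaryDilation Q T) :=
  ⟨⟨QDilation.brehmerPositive_of_regular hT, hT.hasRegularQUnitaryDilation⟩,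
    fun hi => hT.hasRegularQUnitaryDilation (hT.brehmerPositive_of_isometry hi),
    fun hd => hT.hasRegularQUnitaryDilation (hd.brehmerPositive hc),
    fun _ hs h1 => hT.hasRegularQUnitaryDilation (hT.brehmerPositive_of_tsum_le_one hs h1)⟩
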